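/- Throughout, graphs are finite and simple. For graphs $F,G$ let $p(F,G)$ be the number of $|V(F)|$-subsets of $V(G)$ that induce a subgraph isomorphic to $F$, divided by $\binom{|V(G)|}{|V(F)|}$. Let $i(F)=\lim_{n\to\infty}\max_G p(F,G)$, the maximum being over all graphs $G$ on $n$ vertices, and let $i_k(F)$ be the same limit with the maximum restricted to $K_k$-free graphs $G$ on $n$ vertices. For a point $(x_1,\dots,x_m)$ of the standard simplex ($x_i\ge 0$, $\sum_i x_i=1$) let $W[x_1,\dots,x_m]:[0,1]^2\to\{0,1\}$ be the complete $m$-partite graphon: split $[0,1]$ into consecutive intervals of lengths $x_1,\dots,x_m$ (zero lengths are allowed) and put $W(x,y)=1$ if and only if $x,y$ lie in distinct intervals. The induced density of $F$ in a graphon $W$ is the probability that $|V(F)|$ independent uniform points of $[0,1]$ induce a copy of $F$ in $W$. We say that $i_k(F)$ is uniquely attained by $W[\frac1\ell,\dots,\frac1\ell]$ ($\ell$ parts, $1\le\ell<k$) if the induced density of $F$ in this graphon is $i_k(F)$, and every point $(x_1,\dots,x_m)$ of a standard simplex with $m<k$ for which $F$ has induced density $i_k(F)$ in $W[x_1,\dots,x_m]$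 has exactly $\ell$ nonzero coordinates, each equal to $\frac1\ell$; for $i(F)$ the definition is the same without the conditions $\ell<k$ and $m<k$. Let $T(s,r)$ be the Turán graph, i.e. the complete $r$-partite graph on $s$ vertices whose part sizes differ by at most one. For $\ell\ge r$ and $s=pr+q$ with $0\le q<r$ let $$g_{s,r}(\ell)=\frac{\ell!\,s!}{(\ell-r)!\,(r-q)!\,q!\,(p!)^r\,(p+1)^q\,\ell^{s}}.$$ **Theorem.** Let $2\le r\le s\le 14$, $F=T(s,r)$, and let $k$ range over the integers $k\ge 3$. (a) Suppose $r<s$, and let $t=t(s,r)$ and $v=v(s,r)$ be the entries of the table below. Then $i(F)=v$, and it is uniquely attained by $W[\frac1t,\dots,\frac1t]$ ($t$ parts). If $k\le r$, then $i_k(F)=0$. If $r<k\le t$, then $i_k(F)=g_{s,r}(k-1)$, and it is uniquely attained by $W[\frac1{k-1},\dots,\frac1{k-1}]$ ($k-1$ parts). If $k>t$, then $i_k(F)=v$, and it is uniquely attained by $W[\frac1t,\dots,\frac1t]$ ($t$ parts). (b) Suppose $r=s$, so that $F=K_r$. Then $i(F)=1$. If $k\le r$, then $i_k(F)=0$. If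 $k>r$, then $i_k(F)=g_{r,r}(k-1)$, and it is uniquely attained by $W[\frac1{k-1},\dots,\frac1{k-1}]$ ($k-1$ parts). $$\begin{array}{c|c|c|c} s & r & t(s,r) & v(s,r)\\ \hline 3 & 2 & 2 & 3/4 \\ 4 & 2 & 2 & 3/8 \\ 4 & 3 & 5 & 72/125 \\ 5 & 2 & 2 & 5/8 \\ 5 & 3 & 3 & 10/27 \\ 5 & 4 & 8 & 525/1024 \\ 6 & 2 & 2 & 5/16 \\ 6 & 3 & 3 & 10/81 \\ 6 & 4 & 6 & 25/72 \\ 6 & 5 & 13 & 178200/371293 \\ 7 & 2 & 2 & 35/64 \\ 7 & 3 & 3 & 70/243 \\ 7 & 4 & 5 & 504/3125 \\ 7 & 5 & 8 & 11025/32768 \\ 7 & 6 & 19 & 21591360/47045881 \\ 8 & 2 & 2 & 35/128 \\ 8 & 3 & 3 & 560/2187 \\ 8 & 4 & 4 & 315/8192 \\ 8 & 5 & 7 & 21600/117649 \\ 8 & 6 & 11 & 6350400/19487171 \\ 8 & 7 & 25 & 542691072/1220703125 \\ 9 & 2 & 2 & 63/128 \\ 9 & 3 & 3 & 560/6561 \\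 9 & 4 & 4 & 945/8192 \\ 9 & 5 & 6 & 175/2592 \\ 9 & 6 & 9 & 313600/1594323 \\ 9 & 7 & 15 & 224224/703125 \\ 9 & 8 & 33 & 837724160/1929229929 \\ 10 & 2 & 2 & 63/256 \\ 10 & 3 & 3 & 1400/6561 \\ 10 & 4 & 4 & 4725/32768 \\ 10 & 5 & 5 & 4536/390625 \\ 10 & 6 & 8 & 1488375/16777216 \\ 10 & 7 & 12 & 67375/331776 \\ 10 & 8 & 19 & 101047564800/322687697779 \\ 10 & 9 & 42 & 796235375/1867795524 \\ 11 & 2 & 2 & 231/512 \\ 11 & 3 & 3 & 3850/19683 \\ 11 & 4 & 4 & 5775/65536 \\ 11 & 5 & 5 & 16632/390625 \\ 11 & 6 & 7 & 1069200/40353607 \\ 11 & 7 & 10 & 130977/1250000 \\ 11 & 8 & 15 & 19731712/94921875 \\ 11 & 9 & 24 & 157309075/509607936 \\ 11 & 10 & 51 & 617338863680000/1469659553427321 \\ 12 & 2 & 2 & 231/1024 \\ 12 & 3 & 3 & 3850/59049 \\ 12 & 4 & 4 & 5775/262144 \\ 12 & 5 & 5 & 133056/1953125 \\ 12 & 6 &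 7 & 1069200/282475249 \\ 12 & 7 & 9 & 1724800/43046721 \\ 12 & 8 & 12 & 3705625/31850496 \\ 12 & 9 & 18 & 163788625/774840978 \\ 12 & 10 & 29 & 3721968169920000/12200509765705829 \\ 12 & 11 & 62 & 21091312901233575/50816953792809662 \\ 13 & 2 & 2 & 429/1024 \\ 13 & 3 & 3 & 10010/59049 \\ 13 & 4 & 4 & 75075/1048576 \\ 13 & 5 & 5 & 576576/9765625 \\ 13 & 6 & 6 & 25025/1679616 \\ 13 & 7 & 8 & 42567525/4294967296 \\ 13 & 8 & 11 & 14859936000/285311670611 \\ 13 & 9 & 15 & 897792896/7119140625 \\ 13 & 10 & 22 & 243737778375/1141246682444 \\ 13 & 11 & 35 & 233296472927232/772393258984375 \\ 13 & 12 & 74 & 2704936173225986700/6582952005840035281 \\ 14 & 2 & 2 & 429/2048 \\ 14 & 3 & 3 & 28028/177147 \\ 14 & 4 & 4 & 1576575/16777216 \\ 14 & 5 & 5 & 1345344/48828125 \\ 14 & 6 & 6 & 875875/30233088 \\ 14 & 7 & 8 & 42567525/34359738368 \\ 14 & 8 & 10 & 107270163/6250000000 \\ 14 & 9 & 13 & 1452272976000/23298085122481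 \\ 14 & 10 & 18 & 14904764875/111577100832 \\ 14 & 11 & 26 & 20068705243125/93192340489924 \\ 14 & 12 & 41 & 277115986307736576000/925103102315013629321 \\ 14 & 13 & 86 & 2800242205096869658125/6873056497129163140972 \end{array}$$ -/

import Mathlib

open Filter Topology MeasureTheory
open scoped Nat unitInterval

noncomputable section

/-! ### Induced density and inducibility through finite graphs -/

open Classical in
/-- `P(F, G)`: the number of vertex subsets of `G` that induce a subgraph isomorphic to `F`. -/
def inducedCopies {V W : Type*} [Fintype W] (F : SimpleGraph V) (G : SimpleGraph W) : ℕ :=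
  (Finset.univ.filter fun S : Finset W => Nonempty (G.induce (S : Set W) ≃g F)).card

/-- `p(F, G) = P(F, G) / binom(|V(G)|, |V(F)|)`: the induced density of `F` in `G`. -/
def inducedDensity {V W : Type*} [Fintype V] [Fintype W] (F : SimpleGraph V)
    (G : SimpleGraph W) : ℝ :=
  (inducedCopies F G : ℝ) / ((Fintype.card W).choose (Fintype.card V) : ℝ)

/-- `i(F, n)`: the maximum of `p(F, G)` over all graphs `G` on `n` vertices
(a supremum over a finite nonempty set). -/
def maxInducedDensity {V : Type*} [Fintype V] (F : SimpleGraph V) (n : ℕ) : ℝ :=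
  ⨆ G : SimpleGraph (Fin n), inducedDensity F G

/-- `i_k(F, n)`: the maximum of `p(F, G)` over all `K_k`-free graphs `G` on `n` vertices
(a supremum over a finite set, which is nonempty for `k ≥ 2`). -/
def maxInducedDensityCliqueFree {V : Type*} [Fintype V] (F : SimpleGraph V) (k n : ℕ) : ℝ :=
  ⨆ G : {G : SimpleGraph (Fin n) // G.CliqueFree k}, inducedDensity F G.1

/-- The inducibility `i(F) = lim_n i(F, n)` exists and equals `a`. -/
def IsInducibility {V : Type*} [Fintype V] (F : SimpleGraph V) (a : ℝ) : Prop :=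
  Tendsto (fun n => maxInducedDensity F n) atTop (𝓝 a)

/-- The inducibility over `K_k`-free graphs, `i_k(F) = lim_n i_k(F, n)`, exists and equals `a`. -/
def IsCliqueFreeInducibility {V : Type*} [Fintype V] (F : SimpleGraph V) (k : ℕ) (a : ℝ) : Prop :=
  Tendsto (fun n => maxInducedDensityCliqueFree F k n) atTop (𝓝 a)

/-! ### Graphons -/

/-- A `{0,1}`-valued graphon: a symmetric measurable relation on the unit interval. -/
structure Graphon01 where
  Adj : I → I → Prop
  symm : ∀ y z, Adj y z → Adj z y
  measurable : MeasurableSet {p : I × I | Adj p.1 p.2}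

/-- The graph that the points `p v`, `v ∈ V`, induce in the graphon. -/
def Graphon01.induced {V : Type*} (W : Graphon01) (p : V → I) : SimpleGraph V where
  Adj u v := u ≠ v ∧ W.Adj (p u) (p v)
  symm := ⟨fun _ _ h => ⟨h.1.symm, W.symm _ _ h.2⟩⟩
  loopless := ⟨fun _ h => h.1 rfl⟩

/-- The induced density of `F` in the graphon `W`: the probability that `|V(F)|` independent
uniform points of `[0,1]` induce a copy of `F`. -/
def Graphon01.density {V : Type*} [Fintype V] (W : Graphon01) (F : SimpleGraph V) : ℝ :=
  (volume : Measure (V → I)).real {p | Nonempty (W.induced p ≃g F)}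

/-- The `i`-th of the consecutive intervals of lengths `x 0, x 1, …` that start at `0`. -/
def partInterval {l : ℕ} (x : Fin l → ℝ) (i : Fin l) : Set I :=
  {y | (∑ j ∈ Finset.Iio i, x j) ≤ (y : ℝ) ∧ (y : ℝ) < ∑ j ∈ Finset.Iic i, x j}

theorem measurableSet_partInterval {l : ℕ} (x : Fin l → ℝ) (i : Fin l) :
    MeasurableSet (partInterval x i) :=
  (measurableSet_le measurable_const measurable_subtype_coe).inter
    (measurableSet_lt measurable_subtype_coe measurable_const)

/-- The complete `l`-partite graphon `W[x 0, …, x (l-1)]` for a point `x` of the standard simplex: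
two points are adjacent iff they lie in distinct intervals. Zero entries are allowed.
(The intervals cover `[0,1]` except for its right end point, a null set.) -/
def completePartiteGraphon {l : ℕ} (x : Fin l → ℝ) : Graphon01 where
  Adj y z := ∃ i j, i ≠ j ∧ y ∈ partInterval x i ∧ z ∈ partInterval x j
  symm := fun _ _ ⟨i, j, hij, hy, hz⟩ => ⟨j, i, hij.symm, hz, hy⟩
  measurable := by
    have h : {p : I × I | ∃ i j, i ≠ j ∧ p.1 ∈ partInterval x i ∧ p.2 ∈ partInterval x j} =
        ⋃ i, ⋃ j, ⋃ _ : i ≠ j, partInterval x i ×ˢ partInterval x j := by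
      ext p
      simp only [Set.mem_ofPred_eq, Set.mem_iUnion, Set.mem_prod, exists_prop]
    rw [h]
    exact MeasurableSet.iUnion fun i => MeasurableSet.iUnion fun j => MeasurableSet.iUnion fun _ =>
      (measurableSet_partInterval x i).prod (measurableSet_partInterval x j)

/-- Among the complete `m`-partite graphons with `m < N` parts (zero parts allowed), the value `a`
is the induced density of `F` in the equipartite graphon `W[1/l, …, 1/l]` with `l < N` parts,
and in no other: a point `x` of the simplex with `W[x]` of density `a` has all its nonzero
coordinates equal to `1/l` (so exactly `l` of them are nonzero). -/
def UniquelyAttainedEquipartite {V : Type*} [Fintype V] (F : SimpleGraph V) (N : ℕ∞) (a : ℝ)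
    (l : ℕ) : Prop :=
  1 ≤ l ∧ (l : ℕ∞) < N ∧
  (completePartiteGraphon (fun _ : Fin l => 1 / (l : ℝ))).density F = a ∧
  ∀ m : ℕ, (m : ℕ∞) < N → ∀ x ∈ stdSimplex ℝ (Fin m),
    (completePartiteGraphon x).density F = a → ∀ i, x i = 0 ∨ x i = 1 / (l : ℝ)

/-! ### The table -/

/-- With `s = p r + q`, `0 ≤ q < r`, and `l ≥ r`, the number
`l! s! / ((l-r)! (r-q)! q! (p!)^r (p+1)^q l^s)`. -/
def turanDensity (s r l : ℕ) : ℝ :=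
  ((l ! : ℝ) * (s ! : ℝ)) /
    (((l - r)! : ℝ) * ((r - s % r)! : ℝ) * ((s % r)! : ℝ) * ((s / r)! : ℝ) ^ r *
      ((s / r : ℕ) + 1 : ℝ) ^ (s % r) * (l : ℝ) ^ s)

/-- Rows `(s, r, t, numerator, denominator)` for the Turan graphs `T(s, r)`, `2 ≤ r < s ≤ 14`. -/
def turanTable : List (ℕ × ℕ × ℕ × ℕ × ℕ) :=
  [
   (3, 2, 2, 3, 4),
   (4, 2, 2, 3, 8),
   (4, 3, 5, 72, 125),
   (5, 2, 2, 5, 8),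
   (5, 3, 3, 10, 27),
   (5, 4, 8, 525, 1024),
   (6, 2, 2, 5, 16),
   (6, 3, 3, 10, 81),
   (6, 4, 6, 25, 72),
   (6, 5, 13, 178200, 371293),
   (7, 2, 2, 35, 64),
   (7, 3, 3, 70, 243),
   (7, 4, 5, 504, 3125),
   (7, 5, 8, 11025, 32768),
   (7, 6, 19, 21591360, 47045881),
   (8, 2, 2, 35, 128),
   (8, 3, 3, 560, 2187),
   (8, 4, 4, 315, 8192),
   (8, 5, 7, 21600, 117649),
   (8, 6, 11, 6350400, 19487171),
   (8, 7, 25, 542691072, 1220703125),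
   (9, 2, 2, 63, 128),
   (9, 3, 3, 560, 6561),
   (9, 4, 4, 945, 8192),
   (9, 5, 6, 175, 2592),
   (9, 6, 9, 313600, 1594323),
   (9, 7, 15, 224224, 703125),
   (9, 8, 33, 837724160, 1929229929),
   (10, 2, 2, 63, 256),
   (10, 3, 3, 1400, 6561),
   (10, 4, 4, 4725, 32768),
   (10, 5, 5, 4536, 390625),
   (10, 6, 8, 1488375, 16777216),
   (10, 7, 12, 67375, 331776),
   (10, 8, 19, 101047564800, 322687697779),
   (10, 9, 42, 796235375, 1867795524),
   (11, 2, 2, 231, 512),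
   (11, 3, 3, 3850, 19683),
   (11, 4, 4, 5775, 65536),
   (11, 5, 5, 16632, 390625),
   (11, 6, 7, 1069200, 40353607),
   (11, 7, 10, 130977, 1250000),
   (11, 8, 15, 19731712, 94921875),
   (11, 9, 24, 157309075, 509607936),
   (11, 10, 51, 617338863680000, 1469659553427321),
   (12, 2, 2, 231, 1024),
   (12, 3, 3, 3850, 59049),
   (12, 4, 4, 5775, 262144),
   (12, 5, 5, 133056, 1953125),
   (12, 6, 7, 1069200, 282475249),
   (12, 7, 9, 1724800, 43046721),
   (12, 8, 12, 3705625, 31850496),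
   (12, 9, 18, 163788625, 774840978),
   (12, 10, 29, 3721968169920000, 12200509765705829),
   (12, 11, 62, 21091312901233575, 50816953792809662),
   (13, 2, 2, 429, 1024),
   (13, 3, 3, 10010, 59049),
   (13, 4, 4, 75075, 1048576),
   (13, 5, 5, 576576, 9765625),
   (13, 6, 6, 25025, 1679616),
   (13, 7, 8, 42567525, 4294967296),
   (13, 8, 11, 14859936000, 285311670611),
   (13, 9, 15, 897792896, 7119140625),
   (13, 10, 22, 243737778375, 1141246682444),
   (13, 11, 35, 233296472927232, 772393258984375),
   (13, 12, 74, 2704936173225986700, 6582952005840035281),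
   (14, 2, 2, 429, 2048),
   (14, 3, 3, 28028, 177147),
   (14, 4, 4, 1576575, 16777216),
   (14, 5, 5, 1345344, 48828125),
   (14, 6, 6, 875875, 30233088),
   (14, 7, 8, 42567525, 34359738368),
   (14, 8, 10, 107270163, 6250000000),
   (14, 9, 13, 1452272976000, 23298085122481),
   (14, 10, 18, 14904764875, 111577100832),
   (14, 11, 26, 20068705243125, 93192340489924),
   (14, 12, 41, 277115986307736576000, 925103102315013629321),
   (14, 13, 86, 2800242205096869658125, 6873056497129163140972)
  ]

end

set_option linter.unusedSectionVars false

/-! The problem is moved to `weightedDensity`, a polynomial in vertex weights, whose maximum over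
the simplex is located by two symmetrizations. The first is Zykov's. If `u` and `v` are nonadjacent
and `F` is complete multipartite, then moving all weight of one onto the other, in a suitable
direction, does not lower the density (`add_mul_weightedDensity_le`). Repeating this concentrates
the weight on a clique. The second acts on a clique. With `x u + x v` fixed, put e = (x u - x v) /
(x u + x v). As a function of e², the density lies below the chord joining its value at e = 0
(weights equalized) to its value at e = 1 (weights merged); this is `sq_mul_weightedDensity_top_le`,
and it needs the part sizes of `F` to differ by at most one. A maximizer with two unequal weights
therefore stays a maximizer after merging them, which an induction on the support refutes
(`eq_of_isMax_weightedDensity_top`). Hence only equal weights on `l` clique vertices compete, and a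
strict maximum over `l` gives uniqueness as well.

The passage to finite graphs is by averaging over random blow-ups of a complete graph (lower bound)
and by putting uniform weights on `G` itself (upper bound, with an error factor tending to 1).

For Turán graphs the equipartite density is the explicit g(l), and g(l+1)/g(l) = l^s /
((l+1-r)(l+1)^(s-1)). When r < s, a second-order bound on (1 - 1/L)^s shows that g decreases for
large l, and the finitely many remaining comparisons are evaluated by the kernel. When r = s,
Bernoulli's inequality shows that g increases forever. -/

open Classical in
/-- The density of `F` in the blow-up of the graph `G` with vertex weights `x`: the total weight of
the maps `c` for which `G.comap c` is a copy of `F`. -/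
noncomputable def weightedDensity {V W : Type*} [Fintype V] [DecidableEq V] [Fintype W]
    (F : SimpleGraph V) (G : SimpleGraph W) (x : W → ℝ) : ℝ :=
  ∑ c : V → W, if Nonempty (G.comap c ≃g F) then ∏ z, x (c z) else 0

/-- Move the weight of `v` to `u`. -/
def mergeWeight {W : Type*} [DecidableEq W] (x : W → ℝ) (u v : W) : W → ℝ :=
  fun w => if w = u then x u + x v else if w = v then 0 else x w

/-- Replace the weights of `u` and `v` by their average. -/
noncomputable def averageWeight {W : Type*} [DecidableEq W] (x : W → ℝ) (u v : W) : W → ℝ :=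
  fun w => if w = u ∨ w = v then (x u + x v) / 2 else x w

section
variable {V W : Type*} [Fintype V] [DecidableEq V] [Fintype W]

theorem weightedDensity_nonneg (F : SimpleGraph V) (G : SimpleGraph W) {x : W → ℝ}
    (hx : ∀ w, 0 ≤ x w) : 0 ≤ weightedDensity F G x := by
  unfold weightedDensity
  refine Finset.sum_nonneg fun c _ => ?_
  split_ifs
  exacts [Finset.prod_nonneg fun z _ => hx _, le_rfl]

theorem continuous_weightedDensity (F : SimpleGraph V) (G : SimpleGraph W) :
    Continuous (weightedDensity F G) := by
  unfold weightedDensity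
  refine continuous_finsetSum _ fun c _ => ?_
  split_ifs
  · fun_prop
  · fun_prop

end

/-! ### Recolouring inside a nonadjacent pair, and moving weight between two vertices -/

section
variable {V W : Type*}

/-- Nonadjacency is transitive in the pulled-back graph, so `y` and `z` lie in one part and are
twins there. Thus every colour used by `c` sees `u` if and only if it sees `v`, and exchanging these
two colours at any vertices changes no adjacency. -/
theorem comap_eq_of_isCompleteMultipartite {G : SimpleGraph W} {u v : W} (hG : ¬ G.Adj u v)
    {c d : V → W} (hc : (G.comap c).IsCompleteMultipartite) {y z : V} (hy : c y = u) (hz : c z = v)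
    (hcd : ∀ t, c t = d t ∨ ((c t = u ∨ c t = v) ∧ (d t = u ∨ d t = v))) :
    G.comap d = G.comap c := by
  have hG' : ¬ G.Adj v u := fun h => hG h.symm
  have key : ∀ t, G.Adj (c t) u ↔ G.Adj (c t) v := by
    intro t
    have h1 := hc.trans t y z
    have h2 := hc.trans t z y
    simp only [SimpleGraph.comap_adj, hy, hz] at h1 h2
    constructor
    · intro h
      by_contra h'
      exact h2 h' hG' h
    · intro h
      by_contra h'
      exact h1 h' hG h
  ext s t
  simp only [SimpleGraph.comap_adj]
  have hu : ¬ G.Adj u u := G.loopless.irrefl u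
  have hv : ¬ G.Adj v v := G.loopless.irrefl v
  have ks := key s
  have kt := key t
  have ks' := ks
  have kt' := kt
  rw [G.adj_comm _ u, G.adj_comm _ v] at ks' kt'
  rcases hcd s with hs | ⟨hs | hs, hs' | hs'⟩ <;> rcases hcd t with ht | ⟨ht | ht, ht' | ht'⟩ <;>
    simp_all
variable [Fintype V] [DecidableEq W]

theorem prod_comp_eq_pow_mul_pow_mul (x : W → ℝ) (c : V → W) {u v : W} (huv : u ≠ v) :
    ∏ z, x (c z) = x u ^ (Finset.univ.filter fun z => c z = u).card *
      x v ^ (Finset.univ.filter fun z => c z = v).card *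
      ∏ z with c z ≠ u ∧ c z ≠ v, x (c z) := by
  rw [← Finset.prod_filter_mul_prod_filter_not Finset.univ (fun z => c z = u),
    ← Finset.prod_filter_mul_prod_filter_not
      (Finset.univ.filter fun z => ¬ c z = u) (fun z => c z = v),
    Finset.filter_filter, Finset.filter_filter, ← mul_assoc]
  congr 1
  congr 1
  · rw [← Finset.prod_const]
    exact Finset.prod_congr rfl fun z hz => by rw [(Finset.mem_filter.1 hz).2]
  · have : (Finset.univ.filter fun z => ¬ c z = u ∧ c z = v) =
        Finset.univ.filter fun z => c z = v := by
      ext z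
      simp only [Finset.mem_filter, Finset.mem_univ, true_and]
      exact ⟨fun h => h.2, fun h => ⟨fun h' => huv (h'.symm.trans h), h⟩⟩
    rw [this, ← Finset.prod_const]
    exact Finset.prod_congr rfl fun z hz => by rw [(Finset.mem_filter.1 hz).2]

theorem prod_comp_eq_of_eq_off (x y : W → ℝ) (c : V → W) {u v : W} (huv : u ≠ v)
    (h : ∀ w, w ≠ u → w ≠ v → y w = x w) :
    ∏ z, y (c z) = y u ^ (Finset.univ.filter fun z => c z = u).card *
      y v ^ (Finset.univ.filter fun z => c z = v).card *
      ∏ z with c z ≠ u ∧ c z ≠ v, x (c z) := by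
  rw [prod_comp_eq_pow_mul_pow_mul y c huv]
  congr 1
  refine Finset.prod_congr rfl fun z hz => ?_
  have := (Finset.mem_filter.1 hz).2
  exact h _ this.1 this.2

theorem mergeWeight_left (x : W → ℝ) (u v : W) : mergeWeight x u v u = x u + x v := by
  simp [mergeWeight]

theorem mergeWeight_right (x : W → ℝ) {u v : W} (h : u ≠ v) : mergeWeight x u v v = 0 := by
  simp [mergeWeight, h.symm]

theorem mergeWeight_of_ne (x : W → ℝ) {u v w : W} (hu : w ≠ u) (hv : w ≠ v) :
    mergeWeight x u v w = x w := by
  simp [mergeWeight, hu, hv]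

theorem mergeWeight_nonneg {x : W → ℝ} (hx : ∀ w, 0 ≤ x w) (u v w : W) :
    0 ≤ mergeWeight x u v w := by
  unfold mergeWeight
  split_ifs
  exacts [add_nonneg (hx _) (hx _), le_rfl, hx _]

theorem averageWeight_nonneg {x : W → ℝ} (hx : ∀ w, 0 ≤ x w) (u v w : W) :
    0 ≤ averageWeight x u v w := by
  unfold averageWeight
  split_ifs
  exacts [div_nonneg (add_nonneg (hx _) (hx _)) (by norm_num), hx _]

variable [Fintype W]

theorem sum_eq_add_add_sum_filter (f : W → ℝ) {u v : W} (huv : u ≠ v) :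
    ∑ w, f w = f u + f v + ∑ w with w ≠ u ∧ w ≠ v, f w := by
  rw [← Finset.add_sum_erase _ _ (Finset.mem_univ u),
    ← Finset.add_sum_erase (Finset.univ.erase u) f (a := v) (by simp [huv.symm]), add_assoc]
  congr 3
  ext w
  simp [and_comm]

theorem mergeWeight_mem {x : W → ℝ} (hx : x ∈ stdSimplex ℝ W) {u v : W} (huv : u ≠ v) :
    mergeWeight x u v ∈ stdSimplex ℝ W := by
  refine ⟨mergeWeight_nonneg hx.1 u v, ?_⟩
  rw [← hx.2, sum_eq_add_add_sum_filter _ huv, sum_eq_add_add_sum_filter x huv, mergeWeight_left,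
    mergeWeight_right x huv, add_zero]
  congr 1
  refine Finset.sum_congr rfl fun w hw => ?_
  have := (Finset.mem_filter.1 hw).2
  exact mergeWeight_of_ne x this.1 this.2

theorem averageWeight_mem {x : W → ℝ} (hx : x ∈ stdSimplex ℝ W) {u v : W} (huv : u ≠ v) :
    averageWeight x u v ∈ stdSimplex ℝ W := by
  refine ⟨averageWeight_nonneg hx.1 u v, ?_⟩
  rw [← hx.2, sum_eq_add_add_sum_filter _ huv, sum_eq_add_add_sum_filter x huv]
  congr 1
  · simp [averageWeight]
  refine Finset.sum_congr rfl fun w hw => ?_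
  have := (Finset.mem_filter.1 hw).2
  simp [averageWeight, this.1, this.2]

/-! ### Merging two nonadjacent vertices -/

/-- The contribution of a colouring that uses `u` on `i` vertices and `v` on `j`, but not both
colours. The factors `0 ^ i` and `0 ^ j` are the emptied vertex; the convention `0 ^ 0 = 1` keeps
the colourings that avoid it. -/
theorem pow_mul_pow_le_merge {a b : ℝ} (ha : 0 ≤ a) (hb : 0 ≤ b) {i j : ℕ} (h : i = 0 ∨ j = 0) :
    (a + b) * (a ^ i * b ^ j) ≤
      a * ((a + b) ^ i * 0 ^ j) + b * (0 ^ i * (a + b) ^ j) := by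
  have key : ∀ {a b : ℝ}, 0 ≤ a → 0 ≤ b → ∀ i : ℕ, (a + b) * a ^ (i + 1) ≤ a * (a + b) ^ (i + 1) := by
    intro a b ha hb i
    have : a ^ i ≤ (a + b) ^ i := pow_le_pow_left₀ ha (by linarith) i
    calc (a + b) * a ^ (i + 1) = (a * (a + b)) * a ^ i := by ring
      _ ≤ (a * (a + b)) * (a + b) ^ i := by gcongr
      _ = _ := by ring
  rcases i with _ | i <;> rcases j with _ | j
  · simp
  · have := key hb ha j
    rw [add_comm b a] at this
    simpa using this
  · simpa using key ha hb i
  · simp at h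

end

section
variable {V W : Type*} [Fintype V] [DecidableEq V] [DecidableEq W] [Fintype W]

/-- Colourings are grouped by what remains after `v` is identified with `u`. A full group has a
weight that factors over the vertices, hence depends on `x u` and `x v` only through their sum. -/
theorem sum_prod_fiber_merge (x : W → ℝ) (u v : W) (c : V → W) :
    ∑ d : V → W with (fun z => if d z = v then u else d z) = c, ∏ z, x (d z) =
      ∏ z, ∑ w with (if w = v then u else w) = c z, x w := by
  rw [Finset.prod_univ_sum]
  refine Finset.sum_congr ?_ fun _ _ => rfl
  ext d
  simp [Fintype.mem_piFinset, funext_iff]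

theorem sum_fiber_merge_congr {x y : W → ℝ} {u v : W} (huv : u ≠ v)
    (hadd : y u + y v = x u + x v) (h : ∀ w, w ≠ u → w ≠ v → y w = x w) (w₀ : W) :
    ∑ w with (if w = v then u else w) = w₀, y w =
      ∑ w with (if w = v then u else w) = w₀, x w := by
  by_cases h0 : w₀ = u
  · subst h0
    have : (Finset.univ.filter fun w => (if w = v then w₀ else w) = w₀) = {w₀, v} := by
      ext w
      by_cases hw : w = v <;> simp [hw]
    rw [this, Finset.sum_pair huv, Finset.sum_pair huv, hadd]
  · refine Finset.sum_congr rfl fun w hw => ?_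
    have hw := (Finset.mem_filter.1 hw).2
    split_ifs at hw with h1
    · exact absurd hw.symm h0
    · exact h w (fun h2 => h0 (hw ▸ h2)) h1

/-- Moving weight between two nonadjacent vertices in one of the two directions does not decrease
the density. -/
theorem add_mul_weightedDensity_le {F : SimpleGraph V} (hF : F.IsCompleteMultipartite)
    {G : SimpleGraph W} {x : W → ℝ} (hx : ∀ w, 0 ≤ x w) {u v : W} (huv : u ≠ v)
    (hG : ¬ G.Adj u v) :
    (x u + x v) * weightedDensity F G x ≤
      x u * weightedDensity F G (mergeWeight x u v) +
        x v * weightedDensity F G (mergeWeight x v u) := by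
  classical
  let m : (V → W) → V → W := fun d z => if d z = v then u else d z
  have hfib : ∀ y : W → ℝ, weightedDensity F G y =
      ∑ c, ∑ d with m d = c, if Nonempty (G.comap d ≃g F) then ∏ z, y (d z) else 0 := by
    intro y
    unfold weightedDensity
    rw [Finset.sum_fiberwise]
  have hm1 : ∀ w, w ≠ u → w ≠ v → mergeWeight x u v w = x w := fun w h h' =>
    mergeWeight_of_ne x h h'
  have hm2 : ∀ w, w ≠ u → w ≠ v → mergeWeight x v u w = x w := fun w h h' =>
    mergeWeight_of_ne x h' h
  rw [hfib, hfib, hfib, Finset.mul_sum, Finset.mul_sum, Finset.mul_sum, ← Finset.sum_add_distrib]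
  refine Finset.sum_le_sum fun c _ => ?_
  -- If some good colouring in the group uses both `u` and `v`, the whole group is good and merging
  -- preserves its weight. Otherwise each good colouring avoids `u` or `v`, and the elementary
  -- inequality applies to each one separately.
  by_cases hmix : ∃ d, m d = c ∧ Nonempty (G.comap d ≃g F) ∧ ∃ y z, d y = u ∧ d z = v
  · obtain ⟨d, hd, ⟨e⟩, y, z, hy, hz⟩ := hmix
    have hall : ∀ d', m d' = c → Nonempty (G.comap d' ≃g F) := by
      intro d' hd'
      have h := comap_eq_of_isCompleteMultipartite (d := d') hG
        (hF.comap e.toEmbedding) hy hz ?_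
      · rw [h]; exact ⟨e⟩
      · intro t
        have h1 := congrFun (hd.trans hd'.symm) t
        simp only [m] at h1
        split_ifs at h1 <;> simp_all
    have hsum : ∀ y : W → ℝ, (∑ d with m d = c,
        if Nonempty (G.comap d ≃g F) then ∏ z, y (d z) else 0) =
          ∏ z, ∑ w with (if w = v then u else w) = c z, y w := by
      intro y
      rw [← sum_prod_fiber_merge]
      refine Finset.sum_congr rfl fun d' hd' => ?_
      rw [if_pos (hall d' (Finset.mem_filter.1 hd').2)]
    rw [hsum, hsum, hsum]
    have e1 : ∀ w₀, ∑ w with (if w = v then u else w) = w₀, mergeWeight x u v w =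
        ∑ w with (if w = v then u else w) = w₀, x w :=
      sum_fiber_merge_congr huv (by rw [mergeWeight_left, mergeWeight_right x huv, add_zero]) hm1
    have e2 : ∀ w₀, ∑ w with (if w = v then u else w) = w₀, mergeWeight x v u w =
        ∑ w with (if w = v then u else w) = w₀, x w :=
      sum_fiber_merge_congr huv
        (by rw [mergeWeight_left, mergeWeight_right x huv.symm, zero_add, add_comm]) hm2
    simp only [e1, e2]
    rw [add_mul]
  · rw [Finset.mul_sum, Finset.mul_sum, Finset.mul_sum, ← Finset.sum_add_distrib]
    refine Finset.sum_le_sum fun d hd => ?_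
    split_ifs with hgood
    · rw [prod_comp_eq_pow_mul_pow_mul x d huv, prod_comp_eq_of_eq_off x _ d huv hm1,
        prod_comp_eq_of_eq_off x _ d huv hm2, mergeWeight_left, mergeWeight_left,
        mergeWeight_right x huv, mergeWeight_right x huv.symm]
      have hR : 0 ≤ ∏ z with d z ≠ u ∧ d z ≠ v, x (d z) := Finset.prod_nonneg fun z _ => hx _
      have h01 : (Finset.univ.filter fun z => d z = u).card = 0 ∨
          (Finset.univ.filter fun z => d z = v).card = 0 := by
        by_contra! h
        obtain ⟨y, hy⟩ := Finset.card_ne_zero.1 h.1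
        obtain ⟨z, hz⟩ := Finset.card_ne_zero.1 h.2
        exact hmix ⟨d, (Finset.mem_filter.1 hd).2, hgood, y, z, (Finset.mem_filter.1 hy).2,
          (Finset.mem_filter.1 hz).2⟩
      have := mul_le_mul_of_nonneg_right (pow_mul_pow_le_merge (hx u) (hx v) h01) hR
      rw [add_comm (x v) (x u)]
      linarith
    · simp

/-! ### Two vertices of a complete graph -/

/-- The sum is a polynomial in e² with nonnegative coefficients, hence convex in e² and below its
chord, with value 2 at e = 0 and 2^(n+1) at e = 1. The bound on the difference is carried along to
close the induction. -/
theorem half_pow_add_half_pow_le {e : ℝ} (h0 : 0 ≤ e) (h1 : e ≤ 1) (n : ℕ) :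
    (1 + e) ^ (n + 1) + (1 - e) ^ (n + 1) ≤ 2 + 2 * e ^ 2 * (2 ^ n - 1) ∧
      (1 + e) ^ (n + 1) - (1 - e) ^ (n + 1) ≤ 2 * e * 2 ^ n := by
  induction n with
  | zero => exact ⟨by norm_num, le_of_eq (by ring)⟩
  | succ n ih =>
    obtain ⟨hP, hQ⟩ := ih
    have hpow : (1 : ℝ) ≤ 2 ^ n := one_le_pow₀ (by norm_num)
    have he : e ^ 2 ≤ 1 := by nlinarith
    have a1 : (1 + e) ^ (n + 1 + 1) + (1 - e) ^ (n + 1 + 1) =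
        ((1 + e) ^ (n + 1) + (1 - e) ^ (n + 1)) +
          e * ((1 + e) ^ (n + 1) - (1 - e) ^ (n + 1)) := by ring
    have a2 : (1 + e) ^ (n + 1 + 1) - (1 - e) ^ (n + 1 + 1) =
        ((1 + e) ^ (n + 1) - (1 - e) ^ (n + 1)) +
          e * ((1 + e) ^ (n + 1) + (1 - e) ^ (n + 1)) := by ring
    have b1 := mul_le_mul_of_nonneg_left hQ h0
    have b2 := mul_le_mul_of_nonneg_left hP h0
    have b3 : e * (e ^ 2 * (2 ^ n - 1)) ≤ e * (1 * (2 ^ n - 1)) := by gcongr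
    rw [a1, a2, pow_succ 2 n]
    constructor
    · nlinarith
    · nlinarith

theorem pow_add_pow_le_merge {a b : ℝ} (ha : 0 ≤ a) (hb : 0 ≤ b) (n : ℕ) :
    (a + b) ^ 2 * (a ^ (n + 1) + b ^ (n + 1)) ≤
      (a - b) ^ 2 * (a + b) ^ (n + 1) + 4 * (a * b) * (2 * ((a + b) / 2) ^ (n + 1)) := by
  wlog hab : b ≤ a generalizing a b
  · have := this hb ha (le_of_not_ge hab)
    calc _ = (b + a) ^ 2 * (b ^ (n + 1) + a ^ (n + 1)) := by ring
      _ ≤ _ := this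
      _ = _ := by ring
  rcases (add_nonneg ha hb).eq_or_lt with h | h
  · have ha0 : a = 0 := by linarith
    have hb0 : b = 0 := by linarith
    simp [ha0, hb0]
  -- Scaling `a + b` to 2 turns `a` and `b` into 1 + e and 1 - e. Then e² and 1 - e² are `(a - b) ^
  -- 2` and `4 * (a * b)` divided by `(a + b) ^ 2`, the weights of the chord.
  obtain ⟨h1, -⟩ := half_pow_add_half_pow_le (e := (a - b) / (a + b))
    (div_nonneg (by linarith) h.le) ((div_le_one h).2 (by linarith)) n
  have e1 : (1 + (a - b) / (a + b)) = a / ((a + b) / 2) := by field_simp; ring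
  have e2 : (1 - (a - b) / (a + b)) = b / ((a + b) / 2) := by field_simp; ring
  rw [e1, e2, div_pow a, div_pow b, ← add_div,
    div_le_iff₀ (by positivity)] at h1
  have h2 := mul_le_mul_of_nonneg_left h1 (sq_nonneg (a + b))
  refine h2.trans (le_of_eq ?_)
  have h3 : (a + b) ^ (n + 1) = 2 * 2 ^ n * ((a + b) / 2) ^ (n + 1) := by
    rw [div_pow, pow_succ 2 n]; field_simp
  rw [h3]
  field_simp
  ring

/-- When both exponents are positive the merged term vanishes. As they differ by at most one, the
left side is a power of `a * b` times 2 or `a + b`; AM-GM on all but one of the factors `a * b` then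
suffices. This is what balance of the parts is for. -/
theorem pow_mul_pow_add_le_merge {a b : ℝ} (ha : 0 ≤ a) (hb : 0 ≤ b) {i j : ℕ}
    (h : i = 0 ∨ j = 0 ∨ (i ≤ j + 1 ∧ j ≤ i + 1)) :
    (a + b) ^ 2 * (a ^ i * b ^ j + a ^ j * b ^ i) ≤
      (a - b) ^ 2 * ((a + b) ^ i * 0 ^ j + (a + b) ^ j * 0 ^ i) +
        4 * (a * b) * (2 * (((a + b) / 2) ^ i * ((a + b) / 2) ^ j)) := by
  have h4 : 4 * (a * b) = (a + b) ^ 2 - (a - b) ^ 2 := by ring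
  have hu : a * b ≤ ((a + b) / 2) ^ 2 := by nlinarith [sq_nonneg (a - b)]
  have hab := mul_nonneg ha hb
  have key : ∀ n : ℕ, (a + b) ^ 2 * (a * b) ^ (n + 1) ≤
      4 * (a * b) * (((a + b) / 2) ^ (n + 1)) ^ 2 := by
    intro n
    calc (a + b) ^ 2 * (a * b) ^ (n + 1) = (a + b) ^ 2 * (a * b) * (a * b) ^ n := by ring
      _ ≤ (a + b) ^ 2 * (a * b) * (((a + b) / 2) ^ 2) ^ n := by gcongr
      _ = _ := by rw [← pow_mul ((a + b) / 2) (n + 1), mul_comm (n + 1) 2, pow_mul]; ring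
  rcases i with _ | i
  · rcases j with _ | j
    · simp only [pow_zero, mul_one]; rw [h4]; linarith
    · have := pow_add_pow_le_merge ha hb j
      simp only [pow_zero, mul_one, one_mul, ne_eq, Nat.add_eq_zero_iff, one_ne_zero, and_false,
        not_false_eq_true, zero_pow, zero_add]
      linarith
  rcases j with _ | j
  · have := pow_add_pow_le_merge ha hb i
    simp only [pow_zero, mul_one, one_mul, ne_eq, Nat.add_eq_zero_iff, one_ne_zero, and_false,
      not_false_eq_true, zero_pow, add_zero, mul_zero]
    linarith
  simp only [ne_eq, Nat.add_eq_zero_iff, one_ne_zero, and_false,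
      not_false_eq_true, zero_pow, mul_zero, add_zero, zero_add]
  have hcases : i = j ∨ i = j + 1 ∨ j = i + 1 := by omega
  rcases hcases with rfl | rfl | rfl
  · have := key i
    rw [mul_pow] at this
    nlinarith
  · have := mul_le_mul_of_nonneg_right (key j) (add_nonneg ha hb)
    calc _ = (a + b) ^ 2 * (a * b) ^ (j + 1) * (a + b) := by ring
      _ ≤ _ := this
      _ = _ := by ring
  · have := mul_le_mul_of_nonneg_right (key i) (add_nonneg ha hb)
    calc _ = (a + b) ^ 2 * (a * b) ^ (i + 1) * (a + b) := by ring
      _ ≤ _ := this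
      _ = _ := by ring

/-- The sizes of any two classes of nonadjacent vertices differ by at most one. -/
def HasBalancedParts (F : SimpleGraph V) : Prop :=
  ∀ y z, Nat.card {t // ¬ F.Adj y t} ≤ Nat.card {t // ¬ F.Adj z t} + 1

theorem HasBalancedParts.card_fiber_le {F : SimpleGraph V} (hF : HasBalancedParts F) {c : V → W}
    (e : (⊤ : SimpleGraph W).comap c ≃g F) (y z : V) :
    (Finset.univ.filter fun t => c t = c y).card ≤
      (Finset.univ.filter fun t => c t = c z).card + 1 := by
  have key : ∀ y, (Finset.univ.filter fun t => c t = c y).card =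
      Nat.card {t // ¬ F.Adj (e y) t} := by
    intro y
    rw [← Fintype.card_subtype, ← Nat.card_eq_fintype_card]
    refine Nat.card_congr (e.toEquiv.subtypeEquiv fun t => ?_)
    have : F.Adj (e y) (e t) ↔ _ := e.map_adj_iff
    rw [RelIso.coe_fn_toEquiv, this]
    simp [eq_comm]
  rw [key, key]
  exact hF _ _

theorem comap_top_swap_comp (c : V → W) (u v : W) :
    (⊤ : SimpleGraph W).comap (Equiv.swap u v ∘ c) = (⊤ : SimpleGraph W).comap c := by
  ext; simp

/-- For a balanced complete multipartite graph, the density in a complete multipartite graphon is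
bounded by a chord when two parts are equalized or merged. -/
theorem sq_mul_weightedDensity_top_le {F : SimpleGraph V} (hF : HasBalancedParts F)
    {x : W → ℝ} (hx : ∀ w, 0 ≤ x w) {u v : W} (huv : u ≠ v) :
    (x u + x v) ^ 2 * weightedDensity F ⊤ x ≤
      (x u - x v) ^ 2 * weightedDensity F ⊤ (mergeWeight x u v) +
        4 * (x u * x v) * weightedDensity F ⊤ (averageWeight x u v) := by
  classical
  -- In a complete graph, exchanging the colours `u` and `v` preserves goodness. Pairing each
  -- colouring with its exchange produces the symmetrized monomials of `pow_mul_pow_add_le_merge`.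
  have hsymm : ∀ y : W → ℝ, 2 * weightedDensity F ⊤ y =
      ∑ c : V → W, if Nonempty ((⊤ : SimpleGraph W).comap c ≃g F) then
        (∏ z, y (c z) + ∏ z, y (Equiv.swap u v (c z))) else 0 := by
    intro y
    have h2 : weightedDensity F ⊤ y =
        ∑ c : V → W, if Nonempty ((⊤ : SimpleGraph W).comap c ≃g F) then
          ∏ z, y (Equiv.swap u v (c z)) else 0 := by
      unfold weightedDensity
      rw [← Equiv.sum_comp (Equiv.arrowCongr (Equiv.refl V) (Equiv.swap u v))]
      refine Finset.sum_congr rfl fun c _ => ?_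
      have : (Equiv.arrowCongr (Equiv.refl V) (Equiv.swap u v)) c = Equiv.swap u v ∘ c := rfl
      rw [this, comap_top_swap_comp]
      rfl
    rw [two_mul]
    nth_rewrite 2 [h2]
    unfold weightedDensity
    rw [← Finset.sum_add_distrib]
    refine Finset.sum_congr rfl fun c _ => ?_
    split_ifs <;> simp
  have hswap : ∀ (y : W → ℝ) (c : V → W), (∀ w, w ≠ u → w ≠ v → y w = x w) →
      ∏ z, y (Equiv.swap u v (c z)) = y v ^ (Finset.univ.filter fun z => c z = u).card *
        y u ^ (Finset.univ.filter fun z => c z = v).card *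
        ∏ z with c z ≠ u ∧ c z ≠ v, x (c z) := by
    intro y c h
    have := prod_comp_eq_of_eq_off x (fun w => y (Equiv.swap u v w)) c huv ?_
    · simpa using this
    · intro w h1 h2
      rw [Equiv.swap_apply_of_ne_of_ne h1 h2, h w h1 h2]
  have hm : ∀ w, w ≠ u → w ≠ v → mergeWeight x u v w = x w := fun w h h' =>
    mergeWeight_of_ne x h h'
  have ha : ∀ w, w ≠ u → w ≠ v → averageWeight x u v w = x w := fun w h h' => by
    simp [averageWeight, h, h']
  have hau : averageWeight x u v u = (x u + x v) / 2 := by simp [averageWeight]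
  have hav : averageWeight x u v v = (x u + x v) / 2 := by simp [averageWeight]
  suffices h : (x u + x v) ^ 2 * (2 * weightedDensity F ⊤ x) ≤
      (x u - x v) ^ 2 * (2 * weightedDensity F ⊤ (mergeWeight x u v)) +
        4 * (x u * x v) * (2 * weightedDensity F ⊤ (averageWeight x u v)) by linarith
  rw [hsymm, hsymm, hsymm, Finset.mul_sum, Finset.mul_sum, Finset.mul_sum,
    ← Finset.sum_add_distrib]
  refine Finset.sum_le_sum fun c _ => ?_
  split_ifs with hc
  · obtain ⟨e⟩ := hc
    rw [prod_comp_eq_pow_mul_pow_mul x c huv, hswap x c fun _ _ _ => rfl,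
      prod_comp_eq_of_eq_off x _ c huv hm, hswap _ c hm,
      prod_comp_eq_of_eq_off x _ c huv ha, hswap _ c ha, mergeWeight_left,
      mergeWeight_right x huv, hau, hav]
    have hR : 0 ≤ ∏ z with c z ≠ u ∧ c z ≠ v, x (c z) := Finset.prod_nonneg fun z _ => hx _
    set i := (Finset.univ.filter fun z => c z = u).card with hi
    set j := (Finset.univ.filter fun z => c z = v).card with hj
    have hij : i = 0 ∨ j = 0 ∨ (i ≤ j + 1 ∧ j ≤ i + 1) := by
      rcases Nat.eq_zero_or_pos i with h | h
      · exact Or.inl h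
      rcases Nat.eq_zero_or_pos j with h' | h'
      · exact Or.inr (Or.inl h')
      obtain ⟨y, hy⟩ := Finset.card_pos.1 h
      obtain ⟨z, hz⟩ := Finset.card_pos.1 h'
      have hy := (Finset.mem_filter.1 hy).2
      have hz := (Finset.mem_filter.1 hz).2
      have h1 := hF.card_fiber_le e y z
      have h2 := hF.card_fiber_le e z y
      rw [hy, hz] at h1 h2
      exact Or.inr (Or.inr ⟨h1, h2⟩)
    have := mul_le_mul_of_nonneg_right (pow_mul_pow_add_le_merge (hx u) (hx v) hij) hR
    linarith
  · simp
end

section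
variable {V W : Type*} [Fintype V] [DecidableEq V] [Fintype W]

/-! ### Maximizers over the standard simplex -/

theorem weightedDensity_eq_comp {U : Type*} [Fintype U] (F : SimpleGraph V) (G : SimpleGraph W)
    (f : U ↪ W) {x : W → ℝ} (hx : ∀ w, w ∉ Set.range f → x w = 0) :
    weightedDensity F G x = weightedDensity F (G.comap f) (x ∘ f) := by
  classical
  unfold weightedDensity
  symm
  refine Finset.sum_of_injOn (fun c : V → U => f ∘ c)
    (fun c _ d _ h => funext fun z => f.injective (congrFun h z)) (fun _ _ => by simp) ?_ ?_
  · intro c _ hc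
    obtain ⟨z, hz⟩ : ∃ z, c z ∉ Set.range f := by
      by_contra! h
      choose d hd using h
      exact hc ⟨d, by simp, funext hd⟩
    rw [Finset.prod_eq_zero (Finset.mem_univ z) (hx _ hz), ite_self]
  · intro c _
    rfl

theorem weightedDensity_top_eq_zero {F : SimpleGraph V} (hF : F ≠ ⊥) {x : W → ℝ} {u : W}
    (hx : ∀ w, w ≠ u → x w = 0) : weightedDensity F ⊤ x = 0 := by
  classical
  unfold weightedDensity
  refine Finset.sum_eq_zero fun c _ => ?_
  split_ifs with h
  · obtain ⟨e⟩ := h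
    obtain ⟨y, z, hyz⟩ := SimpleGraph.ne_bot_iff_exists_adj.1 hF
    have h1 : ((⊤ : SimpleGraph W).comap c).Adj (e.symm y) (e.symm z) := e.symm.map_adj_iff.2 hyz
    simp only [SimpleGraph.comap_adj, SimpleGraph.top_adj] at h1
    by_cases hy : c (e.symm y) = u
    · exact Finset.prod_eq_zero (Finset.mem_univ (e.symm z)) (hx _ (hy ▸ h1.symm))
    · exact Finset.prod_eq_zero (Finset.mem_univ (e.symm y)) (hx _ hy)
  · rfl

theorem card_support_mergeWeight_lt [DecidableEq W] {x : W → ℝ} {u v : W} (huv : u ≠ v)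
    (hu : x u ≠ 0) (hv : x v ≠ 0) :
    (Finset.univ.filter fun w => mergeWeight x u v w ≠ 0).card <
      (Finset.univ.filter fun w => x w ≠ 0).card := by
  refine Finset.card_lt_card ((Finset.ssubset_iff_of_subset fun w hw => ?_).2
    ⟨v, by simpa using hv, by simp [mergeWeight_right x huv]⟩)
  have hw := (Finset.mem_filter.1 hw).2
  simp only [Finset.mem_filter, Finset.mem_univ, true_and]
  intro h0
  by_cases h1 : w = u
  · exact hu (h1 ▸ h0)
  by_cases h2 : w = v
  · exact hv (h2 ▸ h0)
  exact hw (by rw [mergeWeight_of_ne x h1 h2, h0])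

/-- The coefficients of the chord add up to `(x u + x v) ^ 2`, and the one of the merged point is
positive. A convex combination of values at most `M` can reach `M` only if that value is `M`. -/
theorem weightedDensity_mergeWeight_of_isMax [DecidableEq W] {F : SimpleGraph V}
    (hF : HasBalancedParts F) {M : ℝ} {x : W → ℝ} (hx : x ∈ stdSimplex ℝ W)
    (hM : weightedDensity F ⊤ x = M) (hmax : ∀ y ∈ stdSimplex ℝ W, weightedDensity F ⊤ y ≤ M)
    {u v : W} (huv : x u ≠ x v) : weightedDensity F ⊤ (mergeWeight x u v) = M := by
  have hne : u ≠ v := fun h => huv (h ▸ rfl)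
  have h1 := sq_mul_weightedDensity_top_le hF hx.1 hne
  have h2 := hmax _ (averageWeight_mem hx hne)
  have h3 : 0 ≤ x u * x v := mul_nonneg (hx.1 u) (hx.1 v)
  have h4 : 0 < (x u - x v) ^ 2 := by
    have : x u - x v ≠ 0 := sub_ne_zero.2 huv
    positivity
  refine le_antisymm (hmax _ (mergeWeight_mem hx hne)) (le_of_mul_le_mul_left ?_ h4)
  have h5 := mul_le_mul_of_nonneg_left h2 h3
  rw [hM] at h1
  nlinarith

/-- A maximizer of the density of a balanced complete multipartite graph over complete multipartite
graphons has all its nonempty parts of the same size. -/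
theorem eq_of_isMax_weightedDensity_top {F : SimpleGraph V} (hF : HasBalancedParts F)
    (hF' : F ≠ ⊥) {M : ℝ} (hpos : 0 < M)
    (hmax : ∀ y ∈ stdSimplex ℝ W, weightedDensity F ⊤ y ≤ M) {x : W → ℝ}
    (hx : x ∈ stdSimplex ℝ W) (hM : weightedDensity F ⊤ x = M) :
    ∀ u v, x u ≠ 0 → x v ≠ 0 → x u = x v := by
  classical
  induction hn : (Finset.univ.filter fun w => x w ≠ 0).card using Nat.strong_induction_on
    generalizing x with
  | _ n ih =>
    intro u v hu hv
    by_contra huv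
    have hne : u ≠ v := fun h => huv (h ▸ rfl)
    have key : ∀ u v, x u ≠ 0 → x v ≠ 0 → x u ≠ x v → ∀ w w', mergeWeight x u v w ≠ 0 →
        mergeWeight x u v w' ≠ 0 → mergeWeight x u v w = mergeWeight x u v w' := by
      intro u v hu hv huv
      have hne : u ≠ v := fun h => huv (h ▸ rfl)
      exact ih _ (hn ▸ card_support_mergeWeight_lt hne hu hv) (mergeWeight_mem hx hne)
        (weightedDensity_mergeWeight_of_isMax hF hx hM hmax huv) rfl
    have pu : 0 < x u := lt_of_le_of_ne (hx.1 u) (Ne.symm hu)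
    have pv : 0 < x v := lt_of_le_of_ne (hx.1 v) (Ne.symm hv)
    -- Merged points have smaller support, so by induction their nonzero weights agree. With a third
    -- vertex `d`, merging `u, v` gives `x u + x v = x d`, and merging `d, u` gives `x d + x u = x
    -- v`: impossible for positive weights. Without one, the merged weight sits on a single vertex
    -- and the density is 0.
    by_cases h3 : ∃ d, d ≠ u ∧ d ≠ v ∧ x d ≠ 0
    · obtain ⟨d, hdu, hdv, hd⟩ := h3
      have h1 := key u v hu hv huv u d (by rw [mergeWeight_left]; positivity)
        (by rwa [mergeWeight_of_ne x hdu hdv])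
      rw [mergeWeight_left, mergeWeight_of_ne x hdu hdv] at h1
      have h2 := key d u hd hu (by linarith) d v (by rw [mergeWeight_left]; linarith)
        (by rwa [mergeWeight_of_ne x hdv.symm hne.symm])
      rw [mergeWeight_left, mergeWeight_of_ne x hdv.symm hne.symm] at h2
      linarith
    · push Not at h3
      have h1 := weightedDensity_mergeWeight_of_isMax hF hx hM hmax huv
      rw [weightedDensity_top_eq_zero (u := u) hF'] at h1
      · linarith
      · intro w hw
        by_cases hwv : w = v
        · rw [hwv, mergeWeight_right x hne]
        · rw [mergeWeight_of_ne x hw hwv, h3 w hw hwv]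

/-! ### Reduction to equal weights on a clique -/

/-- The density of `F` in the complete `l`-partite graphon with equal parts. -/
noncomputable def equipartiteDensity (F : SimpleGraph V) (l : ℕ) : ℝ :=
  weightedDensity F (⊤ : SimpleGraph (Fin l)) fun _ => 1 / (l : ℝ)

theorem equipartiteDensity_nonneg (F : SimpleGraph V) (l : ℕ) : 0 ≤ equipartiteDensity F l :=
  weightedDensity_nonneg F _ fun _ => by positivity

theorem exists_embedding_support (x : W → ℝ) :
    ∃ f : Fin (Finset.univ.filter fun w => x w ≠ 0).card ↪ W, ∀ w, w ∈ Set.range f ↔ x w ≠ 0 := by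
  classical
  let e := (Finset.univ.filter fun w => x w ≠ 0).equivFin.symm
  refine ⟨e.toEmbedding.trans (Function.Embedding.subtype _), fun w => ?_⟩
  constructor
  · rintro ⟨i, rfl⟩
    exact (Finset.mem_filter.1 (e i).2).2
  · intro h
    exact ⟨e.symm ⟨w, by simpa using h⟩, by simp⟩

theorem comp_embedding_mem_stdSimplex {U : Type*} [Fintype U] {x : W → ℝ}
    (hx : x ∈ stdSimplex ℝ W) (f : U ↪ W) (hf : ∀ w, w ∉ Set.range f → x w = 0) :
    x ∘ f ∈ stdSimplex ℝ U := by
  classical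
  refine ⟨fun i => hx.1 _, ?_⟩
  rw [← hx.2]
  exact Finset.sum_of_injOn f f.injective.injOn (fun _ _ => by simp)
    (fun w _ hw => hf w (by simpa using hw)) fun _ _ => rfl

theorem card_support_pos {x : W → ℝ} (hx : x ∈ stdSimplex ℝ W) :
    1 ≤ (Finset.univ.filter fun w => x w ≠ 0).card := by
  rw [Nat.one_le_iff_ne_zero, Finset.card_ne_zero]
  by_contra h
  rw [Finset.not_nonempty_iff_eq_empty, Finset.filter_eq_empty_iff] at h
  have := hx.2
  rw [Finset.sum_eq_zero fun w hw => not_not.1 (h hw)] at this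
  exact zero_ne_one this

theorem eq_one_div_card_support {x : W → ℝ} (hx : x ∈ stdSimplex ℝ W)
    (h : ∀ u v, x u ≠ 0 → x v ≠ 0 → x u = x v) {u : W} (hu : x u ≠ 0) :
    x u = 1 / ((Finset.univ.filter fun w => x w ≠ 0).card : ℝ) := by
  have h1 := hx.2
  rw [← Finset.sum_filter_ne_zero, Finset.sum_congr rfl (g := fun _ => x u)
    fun w hw => h w u (Finset.mem_filter.1 hw).2 hu, Finset.sum_const, nsmul_eq_mul] at h1
  have h2 : ((Finset.univ.filter fun w => x w ≠ 0).card : ℝ) ≠ 0 := by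
    have := card_support_pos hx
    positivity
  field_simp
  linarith

theorem weightedDensity_top_eq_equipartiteDensity (F : SimpleGraph V) {x : W → ℝ}
    (hx : x ∈ stdSimplex ℝ W) (h : ∀ u v, x u ≠ 0 → x v ≠ 0 → x u = x v) :
    weightedDensity F ⊤ x =
      equipartiteDensity F (Finset.univ.filter fun w => x w ≠ 0).card := by
  obtain ⟨f, hf⟩ := exists_embedding_support x
  rw [weightedDensity_eq_comp F ⊤ f fun w hw => by simpa [hf] using hw,
    SimpleGraph.comap_top f.injective, equipartiteDensity]
  congr 1
  ext i
  exact eq_one_div_card_support hx h ((hf _).1 ⟨i, rfl⟩)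

/-- By compactness a maximizer exists; if its value is positive, its nonzero weights are equal, and
if the value is 0 any `l` serves. -/
theorem exists_weightedDensity_top_le {F : SimpleGraph V} (hF : HasBalancedParts F)
    (hF' : F ≠ ⊥) {x : W → ℝ} (hx : x ∈ stdSimplex ℝ W) :
    ∃ l, 1 ≤ l ∧ l ≤ Fintype.card W ∧ weightedDensity F ⊤ x ≤ equipartiteDensity F l := by
  obtain ⟨z, hz, hmax⟩ := (isCompact_stdSimplex ℝ W).exists_isMaxOn ⟨x, hx⟩
    (continuous_weightedDensity F (⊤ : SimpleGraph W)).continuousOn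
  refine ⟨(Finset.univ.filter fun w => z w ≠ 0).card, card_support_pos hz,
    Finset.card_le_univ _, ?_⟩
  rcases (weightedDensity_nonneg F (⊤ : SimpleGraph W) hz.1).eq_or_lt with h0 | h0
  · exact (hmax hx).trans (h0.symm.trans_le (equipartiteDensity_nonneg _ _))
  · refine (hmax hx).trans_eq (weightedDensity_top_eq_equipartiteDensity F hz ?_)
    exact eq_of_isMax_weightedDensity_top hF hF' h0 (fun y hy => hmax hy) hz rfl

/-- Zykov symmetrization: `add_mul_weightedDensity_le` bounds the density by an average over the two
merges, so one of them does not decrease it. Each merge shrinks the support, so the process stops.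
-/
theorem exists_isClique_support {F : SimpleGraph V} (hF : F.IsCompleteMultipartite)
    (G : SimpleGraph W) {x : W → ℝ} (hx : x ∈ stdSimplex ℝ W) :
    ∃ y ∈ stdSimplex ℝ W, weightedDensity F G x ≤ weightedDensity F G y ∧
      ∀ u v, y u ≠ 0 → y v ≠ 0 → u ≠ v → G.Adj u v := by
  classical
  induction hn : (Finset.univ.filter fun w => x w ≠ 0).card using Nat.strong_induction_on
    generalizing x with
  | _ n ih =>
    by_cases h : ∀ u v, x u ≠ 0 → x v ≠ 0 → u ≠ v → G.Adj u v
    · exact ⟨x, hx, le_rfl, h⟩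
    push Not at h
    obtain ⟨u, v, hu, hv, huv, hG⟩ := h
    have pu : 0 < x u := lt_of_le_of_ne (hx.1 u) (Ne.symm hu)
    have pv : 0 < x v := lt_of_le_of_ne (hx.1 v) (Ne.symm hv)
    have h1 := add_mul_weightedDensity_le hF hx.1 huv hG
    obtain ⟨a, b, hab, ha, hb, h2⟩ : ∃ a b, a ≠ b ∧ x a ≠ 0 ∧ x b ≠ 0 ∧
        weightedDensity F G x ≤ weightedDensity F G (mergeWeight x a b) := by
      by_cases h2 : weightedDensity F G x ≤ weightedDensity F G (mergeWeight x u v)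
      · exact ⟨u, v, huv, hu, hv, h2⟩
      · refine ⟨v, u, huv.symm, hv, hu, ?_⟩
        by_contra h3
        push Not at h2 h3
        have := mul_lt_mul_of_pos_left h2 pu
        have := mul_lt_mul_of_pos_left h3 pv
        linarith
    obtain ⟨y, hy, h3, h4⟩ := ih _ (hn ▸ card_support_mergeWeight_lt hab ha hb)
      (mergeWeight_mem hx hab) rfl
    exact ⟨y, hy, h2.trans h3, h4⟩

/-- The density of a balanced complete multipartite graph in any weighted graph `G` is at most its
density in an equipartite graphon whose number of parts is the size of a clique of `G`. -/
theorem exists_weightedDensity_le {F : SimpleGraph V} (hF : F.IsCompleteMultipartite)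
    (hbal : HasBalancedParts F) (hF' : F ≠ ⊥) (G : SimpleGraph W) {x : W → ℝ}
    (hx : x ∈ stdSimplex ℝ W) :
    ∃ l, 1 ≤ l ∧ ¬ G.CliqueFree l ∧ weightedDensity F G x ≤ equipartiteDensity F l := by
  obtain ⟨y, hy, hxy, hclique⟩ := exists_isClique_support hF G hx
  obtain ⟨f, hf⟩ := exists_embedding_support y
  have hf0 : ∀ w, w ∉ Set.range f → y w = 0 := fun w hw => by simpa [hf] using hw
  have hcomap : G.comap f = ⊤ := by
    ext i j
    simp only [SimpleGraph.comap_adj, SimpleGraph.top_adj]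
    exact ⟨fun h hij => G.loopless.irrefl _ (hij ▸ h), fun h => hclique _ _ ((hf _).1 ⟨i, rfl⟩)
      ((hf _).1 ⟨j, rfl⟩) fun h' => h (f.injective h')⟩
  obtain ⟨l, hl1, hl, h⟩ := exists_weightedDensity_top_le hbal hF'
    (comp_embedding_mem_stdSimplex hy f hf0)
  refine ⟨l, hl1, fun hfree => ?_, ?_⟩
  · rw [Fintype.card_fin] at hl
    refine hfree.mono hl (Finset.univ.filter fun w => y w ≠ 0) ⟨fun u hu v hv huv => ?_, rfl⟩
    exact hclique u v (by simpa using hu) (by simpa using hv) huv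
  · rw [weightedDensity_eq_comp F G f hf0, hcomap] at hxy
    exact hxy.trans h
end

section
variable {V W : Type*} [Fintype V] [Fintype W]

/-! ### Passing between finite graphs and weighted densities -/

/-- The number of maps `c` for which `G.comap c` is a copy of `F`. -/
noncomputable def copyCount (F : SimpleGraph V) (G : SimpleGraph W) : ℕ :=
  Nat.card {c : V → W // Nonempty (G.comap c ≃g F)}

theorem weightedDensity_const [DecidableEq V] (F : SimpleGraph V) (G : SimpleGraph W) (a : ℝ) :
    weightedDensity F G (fun _ => a) = copyCount F G * a ^ Fintype.card V := by
  classical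
  unfold weightedDensity copyCount
  rw [← Finset.sum_filter, Finset.sum_const, Finset.prod_const, nsmul_eq_mul,
    Nat.card_eq_fintype_card, Fintype.card_subtype, Finset.card_univ]

theorem inducedCopies_eq_card (F : SimpleGraph V) (G : SimpleGraph W) :
    inducedCopies F G = Nat.card {S : Finset W // Nonempty (G.induce (S : Set W) ≃g F)} := by
  classical
  rw [inducedCopies, Nat.card_eq_fintype_card, Fintype.card_subtype]

/-- Each induced copy has `(Fintype.card V)!` labellings, which are maps counted by `copyCount`; the
vertex set is recovered as the image. Non-injective maps may be counted too, hence only an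
inequality. -/
theorem inducedCopies_mul_factorial_le (F : SimpleGraph V) (G : SimpleGraph W) :
    inducedCopies F G * (Fintype.card V)! ≤ copyCount F G := by
  classical
  rw [inducedCopies_eq_card, copyCount, ← Fintype.card_perm, ← Nat.card_eq_fintype_card,
    ← Nat.card_prod]
  let e : ∀ S : {S : Finset W // Nonempty (G.induce (S : Set W) ≃g F)},
    G.induce (S.1 : Set W) ≃g F := fun S => S.2.some
  have himage : ∀ (S : {S : Finset W // Nonempty (G.induce (S : Set W) ≃g F)})
      (ρ : Equiv.Perm V), Set.range (fun z => ((e S).symm (ρ z) : W)) = (S.1 : Set W) := by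
    intro S ρ
    ext w
    constructor
    · rintro ⟨z, rfl⟩
      exact ((e S).symm (ρ z)).2
    · intro hw
      exact ⟨ρ.symm (e S ⟨w, hw⟩), by simp⟩
  refine Nat.card_le_card_of_injective (fun p => ⟨fun z => ((e p.1).symm (p.2 z) : W), ?_⟩) ?_
  · refine ⟨p.2, fun {y z} => ?_⟩
    have : (G.induce (p.1.1 : Set W)).Adj ((e p.1).symm (p.2 y)) ((e p.1).symm (p.2 z)) ↔ _ :=
      (e p.1).symm.map_adj_iff
    rw [← this]
    rfl
  · rintro ⟨S, ρ⟩ ⟨T, τ⟩ h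
    have h := congrArg Subtype.val h
    simp only at h
    have hST : S = T := by
      apply Subtype.ext
      apply Finset.coe_injective
      rw [← himage S ρ, ← himage T τ, h]
    subst hST
    refine Prod.ext rfl (Equiv.ext fun z => ?_)
    have := congrFun h z
    exact (e S).symm.injective (Subtype.ext this)

theorem copyCount_mul_pow_le {U : Type*} [Fintype U] (F : SimpleGraph V) (G : SimpleGraph U)
    (S : Finset W) (hS : S.card = Fintype.card V) :
    copyCount F G * Fintype.card U ^ (Fintype.card W - Fintype.card V) ≤
      Nat.card {c : W → U // Nonempty ((G.comap c).induce (S : Set W) ≃g F)} := by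
  classical
  have h1 : Nat.card ({w : W // w ∉ S} → U) =
      Fintype.card U ^ (Fintype.card W - Fintype.card V) := by
    rw [Nat.card_eq_fintype_card, Fintype.card_fun, Fintype.card_subtype_compl,
      Fintype.card_coe, hS]
  rw [← h1, copyCount, ← Nat.card_prod]
  obtain ⟨e⟩ : Nonempty (V ≃ S) := Fintype.card_eq.1 (by rw [Fintype.card_coe, hS])
  refine Nat.card_le_card_of_injective (fun p : {d : V → U // Nonempty (G.comap d ≃g F)} ×
    ({w : W // w ∉ S} → U) => ⟨fun w => if h : w ∈ S then p.1.1 (e.symm ⟨w, h⟩)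
      else p.2 ⟨w, h⟩, ?_⟩) ?_
  · obtain ⟨i⟩ := p.1.2
    refine ⟨RelIso.trans (s := (G.comap p.1.1).Adj) ⟨e.symm, fun {a b} => ?_⟩ i⟩
    have ha : a.1 ∈ S := a.2
    have hb : b.1 ∈ S := b.2
    simp only [SimpleGraph.comap_adj, SimpleGraph.induce, ha, hb, dif_pos,
      Function.Embedding.subtype_apply]
    rfl
  · rintro ⟨d, f⟩ ⟨d', f'⟩ h
    have h := congrArg Subtype.val h
    simp only at h
    refine Prod.ext (Subtype.ext (funext fun z => ?_)) (funext fun w => ?_)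
    · have := congrFun h (e z)
      simpa using this
    · have := congrFun h w
      simpa [w.2] using this

/-- The left side is the expected induced density of a uniformly random blow-up of `G`, so some
blow-up attains it, for every size of `W` allowed by `h` and without error term. -/
theorem exists_le_inducedDensity {U : Type*} [Fintype U] [Nonempty U] (F : SimpleGraph V)
    (G : SimpleGraph U) (h : Fintype.card V ≤ Fintype.card W) :
    ∃ c : W → U, (copyCount F G : ℝ) / (Fintype.card U : ℝ) ^ Fintype.card V ≤
      inducedDensity F (G.comap c) := by
  classical
  have hU : (0 : ℝ) < Fintype.card U := by exact_mod_cast Fintype.card_pos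
  have hch : (0 : ℝ) < (Fintype.card W).choose (Fintype.card V) := by
    exact_mod_cast Nat.choose_pos h
  have hsum : ((Fintype.card W).choose (Fintype.card V)) *
      (copyCount F G * Fintype.card U ^ (Fintype.card W - Fintype.card V)) ≤
        ∑ c : W → U, inducedCopies F (G.comap c) := by
    have h1 : ∀ c : W → U, inducedCopies F (G.comap c) = ∑ S : Finset W,
        if Nonempty ((G.comap c).induce (S : Set W) ≃g F) then 1 else 0 := by
      intro c
      rw [inducedCopies, Finset.card_filter]
    simp_rw [h1]
    rw [Finset.sum_comm, ← Finset.card_univ (α := W), ← Finset.card_powersetCard, ← smul_eq_mul]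
    refine (Finset.card_nsmul_le_sum _ (fun S : Finset W => ∑ c : W → U,
        if Nonempty ((G.comap c).induce (S : Set W) ≃g F) then 1 else 0) _ fun S hS => ?_).trans
      (Finset.sum_le_sum_of_subset (Finset.subset_univ _))
    refine (copyCount_mul_pow_le F G S (Finset.mem_powersetCard.1 hS).2).trans_eq ?_
    rw [← Finset.card_filter, Nat.card_eq_fintype_card, Fintype.card_subtype]
  by_contra! hlt
  have h2 : ∀ c : W → U, (inducedCopies F (G.comap c) : ℝ) <
      (copyCount F G : ℝ) / (Fintype.card U : ℝ) ^ Fintype.card V *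
        (Fintype.card W).choose (Fintype.card V) := fun c => (div_lt_iff₀ hch).1 (hlt c)
  have h3 := Finset.sum_lt_sum_of_nonempty (Finset.univ_nonempty (α := W → U)) fun c _ => h2 c
  have h4 : (((Fintype.card W).choose (Fintype.card V)) *
      (copyCount F G * Fintype.card U ^ (Fintype.card W - Fintype.card V)) : ℝ) ≤
        ∑ c : W → U, (inducedCopies F (G.comap c) : ℝ) := by exact_mod_cast hsum
  refine absurd (h4.trans_lt h3) (not_lt.2 (le_of_eq ?_))
  rw [Finset.sum_const, Finset.card_univ, Fintype.card_fun, nsmul_eq_mul]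
  push_cast
  have h5 : (Fintype.card U : ℝ) ^ Fintype.card W = (Fintype.card U : ℝ) ^ Fintype.card V *
      (Fintype.card U : ℝ) ^ (Fintype.card W - Fintype.card V) := by
    rw [← pow_add, Nat.add_sub_cancel' h]
  rw [h5]
  field_simp

variable [DecidableEq V]

theorem equipartiteDensity_eq (F : SimpleGraph V) (l : ℕ) :
    equipartiteDensity F l = copyCount F (⊤ : SimpleGraph (Fin l)) / (l : ℝ) ^ Fintype.card V := by
  rw [equipartiteDensity, weightedDensity_const, one_div, inv_pow, div_eq_mul_inv]

/-- Sampling with replacement dominates: maps into `G` include all labelled induced copies. The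
final factor is the ratio of all maps to injective ones. -/
theorem inducedDensity_mul_le {F : SimpleGraph V} {n : ℕ} (hn : 1 ≤ n) {G : SimpleGraph (Fin n)}
    {A : ℝ} (h : weightedDensity F G (fun _ => 1 / (n : ℝ)) ≤ A) (hV : Fintype.card V ≤ n) :
    inducedDensity F G ≤
      A * ((n : ℝ) ^ Fintype.card V / (n.descFactorial (Fintype.card V) : ℝ)) := by
  have hn' : (0 : ℝ) < n := by exact_mod_cast hn
  rw [weightedDensity_const, one_div, inv_pow, ← div_eq_mul_inv, div_le_iff₀ (by positivity)] at h
  have h1 : (inducedCopies F G : ℝ) * (Fintype.card V)! ≤ copyCount F G := by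
    exact_mod_cast inducedCopies_mul_factorial_le F G
  have hd : (0 : ℝ) < n.choose (Fintype.card V) := by exact_mod_cast Nat.choose_pos hV
  have hf : (0 : ℝ) < (Fintype.card V)! := by exact_mod_cast Nat.factorial_pos _
  rw [inducedDensity, Fintype.card_fin, Nat.descFactorial_eq_factorial_mul_choose,
    ← mul_div_assoc, Nat.cast_mul, div_le_div_iff₀ hd (by positivity)]
  have := mul_le_mul_of_nonneg_right (h1.trans h) hd.le
  linarith

theorem tendsto_pow_div_descFactorial (s : ℕ) :
    Tendsto (fun n : ℕ => (n : ℝ) ^ s / (n.descFactorial s : ℝ)) atTop (𝓝 1) := by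
  have h := (isEquivalent_descFactorial s).symm
  refine (Asymptotics.isEquivalent_iff_tendsto_one ?_).1 h
  filter_upwards [eventually_ge_atTop s] with n hn
  have := Nat.descFactorial_pos.2 hn
  positivity

theorem tendsto_of_bounds {i : ℕ → ℝ} {a : ℝ} {s : ℕ} (hlow : ∀ᶠ n in atTop, a ≤ i n)
    (hup : ∀ᶠ n : ℕ in atTop, i n ≤ a * ((n : ℝ) ^ s / (n.descFactorial s : ℝ))) :
    Tendsto i atTop (𝓝 a) := by
  refine tendsto_of_tendsto_of_tendsto_of_le_of_le' tendsto_const_nhds ?_ hlow hup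
  simpa using (tendsto_pow_div_descFactorial s).const_mul a

theorem const_mem_stdSimplex {n : ℕ} (hn : 1 ≤ n) :
    (fun _ => 1 / (n : ℝ)) ∈ stdSimplex ℝ (Fin n) := by
  have hn' : (0 : ℝ) < n := by exact_mod_cast hn
  refine ⟨fun _ => by positivity, ?_⟩
  simp [hn'.ne']

theorem isCliqueFreeInducibility_of_isMax {F : SimpleGraph V} (hF : F.IsCompleteMultipartite)
    (hbal : HasBalancedParts F) (hF' : F ≠ ⊥) {k l : ℕ} (hl : 1 ≤ l) (hlk : l < k)
    (hmax : ∀ m, 1 ≤ m → m < k → equipartiteDensity F m ≤ equipartiteDensity F l) :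
    IsCliqueFreeInducibility F k (equipartiteDensity F l) := by
  have : NeZero l := ⟨by omega⟩
  refine tendsto_of_bounds (s := Fintype.card V) ?_ ?_
  · filter_upwards [eventually_ge_atTop (Fintype.card V)] with n hn
    obtain ⟨c, hc⟩ := exists_le_inducedDensity (W := Fin n) F (⊤ : SimpleGraph (Fin l))
      (by rwa [Fintype.card_fin])
    rw [Fintype.card_fin, ← equipartiteDensity_eq] at hc
    have hfree : ((⊤ : SimpleGraph (Fin l)).comap c).CliqueFree k := by
      intro t ht
      have hinj : Set.InjOn c t := by
        intro a ha b hb hab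
        by_contra hne
        have := ht.1 ha hb hne
        simp [hab] at this
      have h1 := Finset.card_le_card_of_injOn (t := Finset.univ) c (fun _ _ => by simp) hinj
      rw [ht.2, Finset.card_univ, Fintype.card_fin] at h1
      omega
    exact hc.trans (le_ciSup (f := fun G : {G : SimpleGraph (Fin n) // G.CliqueFree k} =>
      inducedDensity F G.1) (Set.finite_range _).bddAbove ⟨_, hfree⟩)
  · filter_upwards [eventually_ge_atTop (Fintype.card V), eventually_ge_atTop 1] with n hn hn1
    refine Real.iSup_le (fun G => inducedDensity_mul_le hn1 ?_ hn) ?_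
    · obtain ⟨m, hm1, hm, h⟩ := exists_weightedDensity_le hF hbal hF' G.1 (const_mem_stdSimplex hn1)
      refine h.trans (hmax m hm1 ?_)
      by_contra! hkm
      exact hm (G.2.mono hkm)
    · have := equipartiteDensity_nonneg F l
      positivity

theorem isInducibility_of_isMax {F : SimpleGraph V} (hF : F.IsCompleteMultipartite)
    (hbal : HasBalancedParts F) (hF' : F ≠ ⊥) {l : ℕ} (hl : 1 ≤ l)
    (hmax : ∀ m, 1 ≤ m → equipartiteDensity F m ≤ equipartiteDensity F l) :
    IsInducibility F (equipartiteDensity F l) := by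
  have : NeZero l := ⟨by omega⟩
  refine tendsto_of_bounds (s := Fintype.card V) ?_ ?_
  · filter_upwards [eventually_ge_atTop (Fintype.card V)] with n hn
    obtain ⟨c, hc⟩ := exists_le_inducedDensity (W := Fin n) F (⊤ : SimpleGraph (Fin l))
      (by rwa [Fintype.card_fin])
    rw [Fintype.card_fin, ← equipartiteDensity_eq] at hc
    exact hc.trans (le_ciSup (f := fun G : SimpleGraph (Fin n) => inducedDensity F G)
      (Set.finite_range _).bddAbove _)
  · filter_upwards [eventually_ge_atTop (Fintype.card V), eventually_ge_atTop 1] with n hn hn1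
    refine Real.iSup_le (fun G => inducedDensity_mul_le hn1 ?_ hn) ?_
    · obtain ⟨m, hm1, hm, h⟩ := exists_weightedDensity_le hF hbal hF' G (const_mem_stdSimplex hn1)
      exact h.trans (hmax m hm1)
    · have := equipartiteDensity_nonneg F l
      positivity

theorem isInducibility_top : IsInducibility (⊤ : SimpleGraph V) 1 := by
  refine tendsto_const_nhds.congr' ?_
  filter_upwards [eventually_ge_atTop (Fintype.card V)] with n hn
  have hch : (0 : ℝ) < n.choose (Fintype.card V) := by exact_mod_cast Nat.choose_pos hn
  have hsub : ∀ G : SimpleGraph (Fin n),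
      inducedCopies (⊤ : SimpleGraph V) G ≤ n.choose (Fintype.card V) := by
    intro G
    classical
    rw [inducedCopies]
    calc _ ≤ (Finset.univ.powersetCard (Fintype.card V) : Finset (Finset (Fin n))).card := by
          refine Finset.card_le_card fun S hS => ?_
          obtain ⟨e⟩ := (Finset.mem_filter.1 hS).2
          have := Fintype.card_congr e.toEquiv
          simpa [Finset.mem_powersetCard] using this
      _ = _ := by simp
  have htop : inducedCopies (⊤ : SimpleGraph V) (⊤ : SimpleGraph (Fin n)) =
      n.choose (Fintype.card V) := by
    refine le_antisymm (hsub _) ?_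
    classical
    rw [inducedCopies]
    calc _ = (Finset.univ.powersetCard (Fintype.card V) : Finset (Finset (Fin n))).card := by simp
      _ ≤ _ := by
          refine Finset.card_le_card fun S hS => ?_
          have hS := (Finset.mem_powersetCard.1 hS).2
          obtain ⟨e⟩ : Nonempty ((S : Set (Fin n)) ≃ V) := Fintype.card_eq.1 (by simpa using hS)
          simp only [Finset.mem_filter, Finset.mem_univ, true_and]
          refine ⟨e, fun {a b} => ?_⟩
          rw [SimpleGraph.top_adj, e.injective.ne_iff]
          exact not_congr Subtype.ext_iff
  refine le_antisymm ?_ (ciSup_le fun G => ?_)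
  · refine le_trans (le_of_eq ?_) (le_ciSup (f := fun G : SimpleGraph (Fin n) =>
      inducedDensity (⊤ : SimpleGraph V) G) (Set.finite_range _).bddAbove ⊤)
    simp only [inducedDensity]
    rw [htop, Fintype.card_fin, div_self hch.ne']
  · rw [inducedDensity, Fintype.card_fin, div_le_one hch]
    exact_mod_cast hsub G
end

/-! ### The induced density in a complete partite graphon -/

section
variable {V : Type*} [Fintype V] {l : ℕ} {x : Fin l → ℝ}

theorem sum_Iic_eq_sum_Iio_add (x : Fin l → ℝ) (i : Fin l) :
    ∑ j ∈ Finset.Iic i, x j = ∑ j ∈ Finset.Iio i, x j + x i := by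
  rw [← Finset.Iio_insert, Finset.sum_insert (by simp), add_comm]

theorem measureReal_partInterval (hx : x ∈ stdSimplex ℝ (Fin l)) (i : Fin l) :
    (volume : Measure I).real (partInterval x i) = x i := by
  have himage : (Subtype.val '' partInterval x i : Set ℝ) =
      Set.Ico (∑ j ∈ Finset.Iio i, x j) (∑ j ∈ Finset.Iic i, x j) := by
    ext y
    constructor
    · rintro ⟨z, hz, rfl⟩
      exact hz
    · intro hy
      have h0 : 0 ≤ ∑ j ∈ Finset.Iio i, x j := Finset.sum_nonneg fun j _ => hx.1 j
      have h1 : ∑ j ∈ Finset.Iic i, x j ≤ 1 := by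
        rw [← hx.2]
        exact Finset.sum_le_sum_of_subset_of_nonneg (Finset.subset_univ _) fun j _ _ => hx.1 j
      exact ⟨⟨y, h0.trans hy.1, hy.2.le.trans h1⟩, hy, rfl⟩
  rw [Measure.real, unitInterval.volume_apply, himage, Real.volume_Ico, sum_Iic_eq_sum_Iio_add,
    add_sub_cancel_left, ENNReal.toReal_ofReal (hx.1 i)]

theorem partInterval_disjoint (hx : ∀ i, 0 ≤ x i) {i j : Fin l} (hij : i ≠ j) {y : I}
    (hi : y ∈ partInterval x i) (hj : y ∈ partInterval x j) : False := by
  wlog h : i < j generalizing i j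
  · exact this hij.symm hj hi (lt_of_le_of_ne (not_lt.1 h) hij.symm)
  have h1 : ∑ t ∈ Finset.Iic i, x t ≤ ∑ t ∈ Finset.Iio j, x t :=
    Finset.sum_le_sum_of_subset_of_nonneg
      (fun t ht => Finset.mem_Iio.2 ((Finset.mem_Iic.1 ht).trans_lt h)) fun t _ _ => hx t
  exact absurd (hi.2.trans_le (h1.trans hj.1)) (lt_irrefl _)

/-- The points whose coordinates lie in the parts prescribed by `c`. -/
def partBox (x : Fin l → ℝ) (c : V → Fin l) : Set (V → I) :=
  Set.univ.pi fun v => partInterval x (c v)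

theorem measurableSet_partBox (x : Fin l → ℝ) (c : V → Fin l) : MeasurableSet (partBox x c) :=
  MeasurableSet.univ_pi fun _ => measurableSet_partInterval x _

theorem measureReal_partBox (hx : x ∈ stdSimplex ℝ (Fin l)) (c : V → Fin l) :
    (volume : Measure (V → I)).real (partBox x c) = ∏ v, x (c v) := by
  rw [Measure.real, partBox, volume_pi_pi, ENNReal.toReal_prod]
  exact Finset.prod_congr rfl fun v _ => measureReal_partInterval hx (c v)

theorem pairwiseDisjoint_partBox (hx : ∀ i, 0 ≤ x i) (s : Set (V → Fin l)) :
    s.PairwiseDisjoint (partBox x) := by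
  intro c _ d _ hcd
  obtain ⟨v, hv⟩ := Function.ne_iff.1 hcd
  refine Set.disjoint_left.2 fun p hp hq => ?_
  exact partInterval_disjoint hx hv (hp v trivial) (hq v trivial)

theorem induced_completePartiteGraphon (hx : ∀ i, 0 ≤ x i) {c : V → Fin l} {p : V → I}
    (hp : p ∈ partBox x c) :
    (completePartiteGraphon x).induced p = (⊤ : SimpleGraph (Fin l)).comap c := by
  ext u v
  simp only [Graphon01.induced, completePartiteGraphon, SimpleGraph.comap_adj,
    SimpleGraph.top_adj]
  constructor
  · rintro ⟨-, i, j, hij, hi, hj⟩ huv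
    have h1 : i = c u := by
      by_contra h
      exact partInterval_disjoint hx h hi (hp u trivial)
    have h2 : j = c v := by
      by_contra h
      exact partInterval_disjoint hx h hj (hp v trivial)
    exact hij (by rw [h1, h2, huv])
  · intro h
    exact ⟨fun huv => h (huv ▸ rfl), c u, c v, h, hp u trivial, hp v trivial⟩

theorem density_completePartiteGraphon [DecidableEq V] (F : SimpleGraph V)
    (hx : x ∈ stdSimplex ℝ (Fin l)) :
    (completePartiteGraphon x).density F = weightedDensity F ⊤ x := by
  classical
  let good : Finset (V → Fin l) :=
    Finset.univ.filter fun c => Nonempty ((⊤ : SimpleGraph (Fin l)).comap c ≃g F)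
  have hunion : ∀ s : Finset (V → Fin l), (volume : Measure (V → I)).real
      (⋃ c ∈ s, partBox x c) = ∑ c ∈ s, ∏ v, x (c v) := by
    intro s
    rw [measureReal_biUnion_finset (pairwiseDisjoint_partBox hx.1 _)
      fun c _ => measurableSet_partBox x c]
    exact Finset.sum_congr rfl fun c _ => measureReal_partBox hx c
  -- The boxes miss points with a coordinate at the right end of the unit interval. They have total
  -- measure `(∑ i, x i) ^ Fintype.card V = 1`, so the miss is null.
  have hfull : ∀ᵐ p ∂(volume : Measure (V → I)),
      p ∈ ⋃ c ∈ (Finset.univ : Finset (V → Fin l)), partBox x c := by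
    have hmeas : MeasurableSet (⋃ c ∈ (Finset.univ : Finset (V → Fin l)), partBox x c) :=
      Finset.measurableSet_biUnion _ fun c _ => measurableSet_partBox x c
    refine (prob_compl_eq_zero_iff hmeas).2 ?_
    have h1 := hunion Finset.univ
    rw [← Fintype.prod_sum (fun (_ : V) i => x i), hx.2, Finset.prod_const_one] at h1
    rw [← ENNReal.toReal_eq_one_iff]
    exact h1
  have hae : {p | Nonempty ((completePartiteGraphon x).induced p ≃g F)}
      =ᵐ[(volume : Measure (V → I))] ⋃ c ∈ good, partBox x c := by
    filter_upwards [hfull] with p hp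
    simp only [Set.mem_iUnion, Finset.mem_univ, exists_true_left] at hp
    obtain ⟨c, hc⟩ := hp
    refine propext ⟨fun h => ?_, fun h => ?_⟩
    · have h : Nonempty ((completePartiteGraphon x).induced p ≃g F) := h
      rw [induced_completePartiteGraphon hx.1 hc] at h
      exact Set.mem_biUnion (show c ∈ good by simpa [good] using h) hc
    · obtain ⟨d, hd, hpd⟩ := Set.mem_iUnion₂.1 h
      show Nonempty ((completePartiteGraphon x).induced p ≃g F)
      rw [induced_completePartiteGraphon hx.1 hpd]
      exact (Finset.mem_filter.1 hd).2
  rw [Graphon01.density, measureReal_congr hae, hunion, weightedDensity, Finset.sum_filter]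

theorem uniquelyAttainedEquipartite_of_isMax [DecidableEq V] {F : SimpleGraph V}
    (hbal : HasBalancedParts F) (hF' : F ≠ ⊥) {N : ℕ∞} {l : ℕ} (hl : 1 ≤ l) (hlN : (l : ℕ∞) < N)
    (hpos : 0 < equipartiteDensity F l)
    (hmax : ∀ m : ℕ, 1 ≤ m → (m : ℕ∞) < N → m ≠ l →
      equipartiteDensity F m < equipartiteDensity F l) :
    UniquelyAttainedEquipartite F N (equipartiteDensity F l) l := by
  refine ⟨hl, hlN, density_completePartiteGraphon F (const_mem_stdSimplex hl), ?_⟩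
  intro m hm x hx hd i
  rw [density_completePartiteGraphon F hx] at hd
  have hlt : ∀ {j : ℕ}, j ≤ m → (j : ℕ∞) < N := fun h => lt_of_le_of_lt (by exact_mod_cast h) hm
  have hle : ∀ y ∈ stdSimplex ℝ (Fin m), weightedDensity F ⊤ y ≤ equipartiteDensity F l := by
    intro y hy
    obtain ⟨j, hj1, hj, h⟩ := exists_weightedDensity_top_le hbal hF' hy
    rw [Fintype.card_fin] at hj
    by_cases hjl : j = l
    · exact hjl ▸ h
    · exact h.trans (hmax j hj1 (hlt hj) hjl).le
  have heq := eq_of_isMax_weightedDensity_top hbal hF' hpos hle hx hd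
  have hcard : (Finset.univ.filter fun w => x w ≠ 0).card = l := by
    by_contra hne
    have h1 := hmax _ (card_support_pos hx)
      (hlt ((Finset.card_le_univ _).trans_eq (Fintype.card_fin m))) hne
    rw [← weightedDensity_top_eq_equipartiteDensity F hx heq, hd] at h1
    exact lt_irrefl _ h1
  by_cases hi : x i = 0
  · exact Or.inl hi
  · right
    rw [eq_one_div_card_support hx heq hi, hcard]
end

/-! ### Counting maps with prescribed fibre sizes -/

/-- The number of points that `c` maps to `w`. -/
def fiberCard {V W : Type*} [Fintype V] [DecidableEq W] (c : V → W) (w : W) : ℕ :=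
  (Finset.univ.filter fun z => c z = w).card

section
variable {V W : Type*} [Fintype V] [Fintype W] [DecidableEq W]

/-- Expanding the power of `∑ w, X w` over all maps `V → W`, the maps with fibre sizes `n` are those
giving the monomial with exponents `n`; its coefficient is the multinomial one. -/
theorem card_fiberCard_eq_mul_prod_factorial {n : W → ℕ} (hn : ∑ w, n w = Fintype.card V) :
    Nat.card {c : V → W // ∀ w, fiberCard c w = n w} * ∏ w, (n w)! = (Fintype.card V)! := by
  classical
  let d : W →₀ ℕ := Finsupp.equivFunOnFinite.symm n
  have hd : d.sum (fun _ m => m) = Fintype.card V := by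
    rw [Finsupp.sum_fintype _ _ fun _ => rfl]
    exact hn
  have h1 := MvPolynomial.coeff_sum_X_pow_of_fintype (R := ℕ) d (Fintype.card V)
  rw [if_pos hd, ← Finset.card_univ (α := V), ← Finset.prod_const,
    Finset.prod_univ_sum, MvPolynomial.coeff_sum] at h1
  have h2 : ∀ c : V → W, MvPolynomial.coeff d
      (∏ z, (MvPolynomial.X (c z) : MvPolynomial W ℕ)) =
        if ∀ w, fiberCard c w = n w then 1 else 0 := by
    intro c
    have : (∏ z, (MvPolynomial.X (c z) : MvPolynomial W ℕ)) =
        MvPolynomial.monomial (∑ z, Finsupp.single (c z) 1) 1 := by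
      rw [MvPolynomial.monomial_sum_one]
      rfl
    rw [this, MvPolynomial.coeff_monomial]
    congr 1
    rw [Finsupp.ext_iff]
    refine propext (forall_congr' fun w => ?_)
    have : (∑ z, Finsupp.single (c z) 1 : W →₀ ℕ) w = fiberCard c w := by
      rw [Finsupp.finsetSum_apply, fiberCard, Finset.card_filter]
      exact Finset.sum_congr rfl fun z _ => by rw [Finsupp.single_apply]
    rw [this]
    rfl
  rw [Finset.sum_congr rfl fun c _ => h2 c, ← Finset.card_filter, Fintype.piFinset_univ] at h1
  rw [Nat.card_eq_fintype_card, Fintype.card_subtype, h1, Nat.cast_id,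
    Finsupp.multinomial_eq_of_support_subset (Finset.subset_univ _), mul_comm]
  have h3 := Nat.multinomial_spec Finset.univ d
  have h4 : ∑ w, d w = Fintype.card V := hn
  rw [h4] at h3
  exact h3

theorem sum_fiberCard (c : V → W) : ∑ w, fiberCard c w = Fintype.card V := by
  rw [← Finset.card_univ (α := V),
    Finset.card_eq_sum_card_fiberwise (f := c) (t := Finset.univ) fun _ _ => by simp]
  rfl

theorem exists_comp_equiv_of_fiberCard_eq {U : Type*} [Fintype U] {c : V → W} {d : U → W}
    (h : ∀ w, fiberCard c w = fiberCard d w) : ∃ e : V ≃ U, ∀ z, d (e z) = c z := by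
  have : ∀ w, Nonempty ({z // c z = w} ≃ {z // d z = w}) := fun w => by
    refine Fintype.card_eq.1 ?_
    rw [Fintype.card_subtype, Fintype.card_subtype]
    exact h w
  exact ⟨Equiv.ofFiberEquiv fun w => (this w).some, fun z => Equiv.ofFiberEquiv_map _ z⟩

theorem fiberCard_comp_equiv {U : Type*} [Fintype U] (d : U → W) (e : V ≃ U) (w : W) :
    fiberCard (fun z => d (e z)) w = fiberCard d w := by
  unfold fiberCard
  rw [← Fintype.card_subtype, ← Fintype.card_subtype]
  exact Fintype.card_congr (e.subtypeEquiv fun _ => Iff.rfl)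

theorem fiberCard_comp_injective {U : Type*} [DecidableEq U] (d : V → U) {f : U → W}
    (hf : Function.Injective f) (u : U) : fiberCard (fun z => f (d z)) (f u) = fiberCard d u := by
  unfold fiberCard
  congr 1
  ext z
  simp [hf.eq_iff]

theorem fiberCard_eq_zero {c : V → W} {w : W} (h : ∀ z, c z ≠ w) : fiberCard c w = 0 := by
  simp [fiberCard, h]
end

/-! ### Turan graphs -/

section
variable {s r : ℕ}

theorem turanGraph_isCompleteMultipartite (s r : ℕ) :
    (SimpleGraph.turanGraph s r).IsCompleteMultipartite :=
  ⟨fun a b c h h' => by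
    simp only [SimpleGraph.turanGraph_adj, not_not] at *
    exact h.trans h'⟩

theorem turanGraph_ne_bot (hr : 2 ≤ r) (hrs : r ≤ s) : SimpleGraph.turanGraph s r ≠ ⊥ := by
  refine SimpleGraph.ne_bot_iff_exists_adj.2 ⟨⟨0, by omega⟩, ⟨1, by omega⟩, ?_⟩
  rw [SimpleGraph.turanGraph_adj]
  simp [Nat.mod_eq_of_lt hr]

/-- The part of a vertex of the Turan graph. -/
def turanPart (hr : 0 < r) (z : Fin s) : Fin r := ⟨z % r, Nat.mod_lt _ hr⟩

theorem turanGraph_adj_iff (hr : 0 < r) {y z : Fin s} :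
    (SimpleGraph.turanGraph s r).Adj y z ↔ turanPart hr y ≠ turanPart hr z := by
  rw [SimpleGraph.turanGraph_adj, Ne, Ne, turanPart, turanPart, Fin.mk.injEq]

theorem fiberCard_turanPart (hr : 0 < r) (i : Fin r) :
    fiberCard (turanPart hr : Fin s → Fin r) i = if (i : ℕ) < s % r then s / r + 1 else s / r := by
  have h := Nat.count_modEq_card s hr i
  rw [Nat.mod_eq_of_lt i.2, Nat.count_eq_card_filter_range] at h
  have h' : fiberCard (turanPart hr : Fin s → Fin r) i =
      ((Finset.range s).filter fun t => t ≡ i [MOD r]).card := by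
    unfold fiberCard
    refine Finset.card_bij (fun z _ => (z : ℕ)) ?_ (fun _ _ _ _ h => Fin.ext h) ?_
    · intro z hz
      have hz := congrArg Fin.val (Finset.mem_filter.1 hz).2
      simp only [turanPart] at hz
      simp [Nat.ModEq, hz, Nat.mod_eq_of_lt i.2]
    · intro t ht
      simp only [Finset.mem_filter, Finset.mem_range, Nat.ModEq, Nat.mod_eq_of_lt i.2] at ht
      exact ⟨⟨t, ht.1⟩, Finset.mem_filter.2 ⟨Finset.mem_univ _, Fin.ext ht.2⟩, rfl⟩
  rw [h', h]
  split_ifs <;> rfl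

theorem turanGraph_hasBalancedParts (hr : 0 < r) :
    HasBalancedParts (SimpleGraph.turanGraph s r) := by
  have key : ∀ y : Fin s, Nat.card {t // ¬ (SimpleGraph.turanGraph s r).Adj y t} =
      fiberCard (turanPart hr : Fin s → Fin r) (turanPart hr y) := by
    intro y
    classical
    rw [Nat.card_eq_fintype_card, Fintype.card_subtype]
    unfold fiberCard
    congr 1
    ext t
    simp only [Finset.mem_filter, Finset.mem_univ, true_and, turanGraph_adj_iff hr, not_not]
    exact eq_comm
  intro y z
  rw [key, key, fiberCard_turanPart, fiberCard_turanPart]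
  split_ifs <;> omega

theorem comap_top_iso_turanGraph_iff {W : Type*} [DecidableEq W] (hr : 0 < r) (hrs : r ≤ s)
    (c : Fin s → W) : Nonempty ((⊤ : SimpleGraph W).comap c ≃g SimpleGraph.turanGraph s r) ↔
      ∃ f : Fin r → W, Function.Injective f ∧ ∃ e : Fin s ≃ Fin s,
        ∀ z, f (turanPart hr (e z)) = c z := by
  constructor
  · rintro ⟨e⟩
    have he : ∀ y z, c y = c z ↔ turanPart hr (e y) = turanPart hr (e z) := by
      intro y z
      have : (SimpleGraph.turanGraph s r).Adj (e y) (e z) ↔ _ := e.map_adj_iff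
      rw [turanGraph_adj_iff hr, SimpleGraph.comap_adj, SimpleGraph.top_adj] at this
      exact (not_iff_not.1 this).symm
    -- As `r ≤ s`, the first `r` vertices represent the `r` parts.
    have hp : ∀ i : Fin r, turanPart hr (Fin.castLE hrs i) = i := fun i =>
      Fin.ext (Nat.mod_eq_of_lt i.2)
    refine ⟨fun i => c (e.symm (Fin.castLE hrs i)), fun i j hij => ?_, e.toEquiv, fun z => ?_⟩
    · have := (he _ _).1 hij
      simpa [hp] using this
    · rw [he]
      simp [hp]
  · rintro ⟨f, hf, e, he⟩
    refine ⟨e, fun {y z} => ?_⟩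
    rw [turanGraph_adj_iff hr, SimpleGraph.comap_adj, SimpleGraph.top_adj, ← he, ← he, hf.ne_iff]

/-- The three possible sizes of a colour class of a copy of the Turan graph. -/
def turanSize (s r : ℕ) : Fin 3 → ℕ := ![0, s / r, s / r + 1]

/-- The number of colour classes of each size in a copy of the Turan graph with `l` colours. -/
def turanType (s r l : ℕ) : Fin 3 → ℕ := ![l - r, r - s % r, s % r]

theorem turanSize_injective (hr : 0 < r) (hrs : r ≤ s) : Function.Injective (turanSize s r) := by
  have : 0 < s / r := Nat.div_pos hrs hr
  intro i j h
  fin_cases i <;> fin_cases j <;> simp [turanSize] at h ⊢ <;> omega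

theorem card_fin_lt {q : ℕ} (h : q ≤ r) : Fintype.card {i : Fin r // (i : ℕ) < q} = q := by
  rw [Fintype.card_subtype]
  rw [← Finset.card_map Fin.valEmbedding]
  have : (Finset.univ.filter fun i : Fin r => (i : ℕ) < q).map Fin.valEmbedding =
      Finset.range q := by
    ext t
    simp only [Finset.mem_map, Finset.mem_filter, Finset.mem_univ, true_and,
      Fin.valEmbedding_apply, Finset.mem_range]
    exact ⟨fun ⟨i, hi, h⟩ => h ▸ hi, fun ht => ⟨⟨t, ht.trans_le h⟩, ht, rfl⟩⟩
  rw [this, Finset.card_range]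

theorem comap_top_iso_turanGraph_iff_type {W : Type*} [Fintype W] [DecidableEq W] (hr : 0 < r)
    (hrs : r ≤ s) (c : Fin s → W) :
    Nonempty ((⊤ : SimpleGraph W).comap c ≃g SimpleGraph.turanGraph s r) ↔
      r ≤ Fintype.card W ∧ ∃ t : W → Fin 3,
        (∀ j, fiberCard t j = turanType s r (Fintype.card W) j) ∧
        ∀ w, fiberCard c w = turanSize s r (t w) := by
  classical
  have hq : s % r ≤ r := (Nat.mod_lt _ hr).le
  rw [comap_top_iso_turanGraph_iff hr hrs]
  constructor
  · rintro ⟨f, hf, e, he⟩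
    have hrW : r ≤ Fintype.card W := by
      simpa using Fintype.card_le_of_injective f hf
    let g : Fin r → Fin 3 := fun i => if (i : ℕ) < s % r then 2 else 1
    let t : W → Fin 3 := fun w => if h : ∃ i, f i = w then g h.choose else 0
    have htf : ∀ i, t (f i) = g i := by
      intro i
      have h : ∃ j, f j = f i := ⟨i, rfl⟩
      simp only [t, dif_pos h, hf h.choose_spec]
    have hg0 : ∀ i, g i ≠ 0 := by
      intro i
      simp only [g]
      split_ifs <;> decide
    have hcnt : ∀ j : Fin 3, j ≠ 0 → fiberCard t j = fiberCard g j := by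
      intro j hj
      unfold fiberCard
      symm
      refine Finset.card_bij (fun i _ => f i) (fun i hi => ?_) (fun _ _ _ _ h => hf h) ?_
      · simpa [htf] using hi
      · intro w hw
        have hw := (Finset.mem_filter.1 hw).2
        by_cases h : ∃ i, f i = w
        · obtain ⟨i, rfl⟩ := h
          exact ⟨i, by simpa [htf] using hw, rfl⟩
        · simp only [t, dif_neg h] at hw
          exact absurd hw.symm hj
    have hg2 : fiberCard g 2 = s % r := by
      rw [← card_fin_lt hq, Fintype.card_subtype]
      unfold fiberCard
      congr 1
      ext i
      simp only [g, Finset.mem_filter, Finset.mem_univ, true_and]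
      split_ifs with h <;> simp [h]
    have hgz : fiberCard g 0 = 0 := fiberCard_eq_zero hg0
    have hgsum := sum_fiberCard g
    rw [Fin.sum_univ_three, hgz, hg2, Fintype.card_fin] at hgsum
    have htsum := sum_fiberCard t
    rw [Fin.sum_univ_three, hcnt 1 (by decide), hcnt 2 (by decide), hg2] at htsum
    refine ⟨hrW, t, fun j => ?_, fun w => ?_⟩
    · fin_cases j
      · simp only [turanType, Fin.zero_eta, Matrix.cons_val_zero]; omega
      · simp only [turanType, Fin.mk_one, Matrix.cons_val_one, Matrix.cons_val_zero]
        rw [hcnt 1 (by decide)]; omega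
      · show fiberCard t 2 = s % r
        rw [hcnt 2 (by decide), hg2]
    · have hc : c = fun z => f (turanPart hr (e z)) := funext fun z => (he z).symm
      rw [hc, fiberCard_comp_equiv (fun z => f (turanPart hr z)) e]
      by_cases h : ∃ i, f i = w
      · obtain ⟨i, rfl⟩ := h
        rw [fiberCard_comp_injective _ hf, fiberCard_turanPart, htf]
        simp only [g]
        split_ifs <;> rfl
      · rw [fiberCard_eq_zero fun z hz => h ⟨_, hz⟩]
        simp only [t, dif_neg h]
        rfl
  · rintro ⟨hrW, t, ht, hc⟩
    obtain ⟨e1⟩ : Nonempty ({i : Fin r // (i : ℕ) < s % r} ≃ {w // t w = 2}) := by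
      refine Fintype.card_eq.1 ?_
      rw [card_fin_lt hq, Fintype.card_subtype]
      exact (ht 2).symm
    obtain ⟨e2⟩ : Nonempty ({i : Fin r // ¬ (i : ℕ) < s % r} ≃ {w // t w = 1}) := by
      refine Fintype.card_eq.1 ?_
      rw [Fintype.card_subtype_compl, card_fin_lt hq, Fintype.card_subtype, Fintype.card_fin]
      exact (ht 1).symm
    let f : Fin r → W := fun i => if h : (i : ℕ) < s % r then e1 ⟨i, h⟩ else e2 ⟨i, h⟩
    have htf : ∀ i, t (f i) = if (i : ℕ) < s % r then 2 else 1 := by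
      intro i
      simp only [f]
      split_ifs with h
      exacts [(e1 ⟨i, h⟩).2, (e2 ⟨i, h⟩).2]
    have hf : Function.Injective f := by
      intro i j hij
      have h1 := congrArg t hij
      rw [htf, htf] at h1
      by_cases hi : (i : ℕ) < s % r <;> by_cases hj : (j : ℕ) < s % r
      · simp only [f, dif_pos hi, dif_pos hj] at hij
        simpa using e1.injective (Subtype.ext hij)
      · simp [hi, hj] at h1
      · simp [hi, hj] at h1
      · simp only [f, dif_neg hi, dif_neg hj] at hij
        simpa using e2.injective (Subtype.ext hij)
    refine ⟨f, hf, exists_comp_equiv_of_fiberCard_eq (d := fun z => f (turanPart hr z))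
      fun w => ?_⟩
    by_cases h : ∃ i, f i = w
    · obtain ⟨i, rfl⟩ := h
      rw [fiberCard_comp_injective _ hf, fiberCard_turanPart, hc, htf]
      split_ifs <;> rfl
    · rw [fiberCard_eq_zero (c := fun z => f (turanPart hr z)) fun z hz => h ⟨_, hz⟩, hc]
      have h0 : t w = 0 := by
        have h1 : t w ≠ 1 := fun h1 => h ⟨e2.symm ⟨w, h1⟩, by
          simp only [f, dif_neg (e2.symm ⟨w, h1⟩).2, Subtype.coe_eta, Equiv.apply_symm_apply]⟩
        have h2 : t w ≠ 2 := fun h2 => h ⟨e1.symm ⟨w, h2⟩, by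
          simp only [f, dif_pos (e1.symm ⟨w, h2⟩).2, Subtype.coe_eta, Equiv.apply_symm_apply]⟩
        omega
      rw [h0]
      rfl

theorem copyCount_turanGraph_of_lt {l : ℕ} (hr : 0 < r) (hrs : r ≤ s) (hl : l < r) :
    copyCount (SimpleGraph.turanGraph s r) (⊤ : SimpleGraph (Fin l)) = 0 := by
  refine Nat.card_eq_zero.2 (Or.inl ⟨fun c => ?_⟩)
  have := ((comap_top_iso_turanGraph_iff_type hr hrs c.1).1 c.2).1
  rw [Fintype.card_fin] at this
  omega

/-- Two multinomial choices: which colours get classes of size 0, `s / r` and `s / r + 1`, then the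
colouring with these class sizes. The three sizes are distinct because `r ≤ s`, so the colouring
determines the first choice. -/
theorem copyCount_turanGraph_mul {l : ℕ} (hr : 0 < r) (hrs : r ≤ s) (hl : r ≤ l) :
    copyCount (SimpleGraph.turanGraph s r) (⊤ : SimpleGraph (Fin l)) *
      (((l - r)! * (r - s % r)! * (s % r)!) * ((s / r)! ^ (r - s % r) * (s / r + 1)! ^ (s % r))) =
        l ! * s ! := by
  classical
  have hq : s % r ≤ r := (Nat.mod_lt _ hr).le
  have htype : Nat.card {t : Fin l → Fin 3 // ∀ j, fiberCard t j = turanType s r l j} *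
      ((l - r)! * (r - s % r)! * (s % r)!) = l ! := by
    have h := card_fiberCard_eq_mul_prod_factorial (V := Fin l) (n := turanType s r l) (by
      rw [Fin.sum_univ_three, Fintype.card_fin]
      simp only [turanType, Matrix.cons_val_zero, Matrix.cons_val_one, Matrix.cons_val]
      omega)
    rw [Fin.prod_univ_three, Fintype.card_fin] at h
    exact h
  have hsize : ∀ t : {t : Fin l → Fin 3 // ∀ j, fiberCard t j = turanType s r l j},
      Nat.card {c : Fin s → Fin l // ∀ w, fiberCard c w = turanSize s r (t.1 w)} *
        ((s / r)! ^ (r - s % r) * (s / r + 1)! ^ (s % r)) = s ! := by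
    rintro ⟨t, ht⟩
    have hfib : ∀ {M : Type} [CommMonoid M] (g : Fin 3 → M),
        ∏ w, g (t w) = g 0 ^ (l - r) * g 1 ^ (r - s % r) * g 2 ^ (s % r) := by
      intro M _ g
      rw [← Finset.prod_fiberwise Finset.univ t, Fin.prod_univ_three]
      have : ∀ j, ∏ w with t w = j, g (t w) = g j ^ turanType s r l j := by
        intro j
        rw [← ht j, fiberCard, ← Finset.prod_const]
        exact Finset.prod_congr rfl fun w hw => by rw [(Finset.mem_filter.1 hw).2]
      rw [this, this, this]
      rfl
    have h := card_fiberCard_eq_mul_prod_factorial (V := Fin s)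
      (n := fun w => turanSize s r (t w)) (by
        -- The product formula read in `Multiplicative ℕ` is the corresponding formula for sums.
        have h1 := hfib (M := Multiplicative ℕ) fun j => Multiplicative.ofAdd (turanSize s r j)
        have h2 : ∑ w, turanSize s r (t w) =
            (l - r) * 0 + (r - s % r) * (s / r) + s % r * (s / r + 1) := h1
        rw [h2, Fintype.card_fin]
        have h3 : (r - s % r) * (s / r) + s % r * (s / r) = r * (s / r) := by
          rw [← add_mul, Nat.sub_add_cancel hq]
        have h4 := Nat.div_add_mod s r
        rw [mul_zero, mul_add]
        omega)
    rw [hfib fun j => (turanSize s r j)!, Fintype.card_fin] at h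
    simpa [turanSize] using h
  have hsigma : copyCount (SimpleGraph.turanGraph s r) (⊤ : SimpleGraph (Fin l)) =
      ∑ t : {t : Fin l → Fin 3 // ∀ j, fiberCard t j = turanType s r l j},
        Nat.card {c : Fin s → Fin l // ∀ w, fiberCard c w = turanSize s r (t.1 w)} := by
    rw [← Nat.card_sigma, copyCount]
    symm
    refine Nat.card_congr (Equiv.ofBijective (fun p => ⟨p.2.1, ?_⟩) ⟨?_, ?_⟩)
    · rw [comap_top_iso_turanGraph_iff_type hr hrs, Fintype.card_fin]
      exact ⟨hl, p.1.1, p.1.2, p.2.2⟩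
    · rintro ⟨⟨t, ht⟩, ⟨c, hc⟩⟩ ⟨⟨t', ht'⟩, ⟨c', hc'⟩⟩ h
      have h : c = c' := congrArg Subtype.val h
      subst h
      have : t = t' := funext fun w => turanSize_injective hr hrs ((hc w).symm.trans (hc' w))
      subst this
      rfl
    · rintro ⟨c, hc⟩
      rw [comap_top_iso_turanGraph_iff_type hr hrs, Fintype.card_fin] at hc
      obtain ⟨-, t, ht, h⟩ := hc
      exact ⟨⟨⟨t, ht⟩, ⟨c, h⟩⟩, rfl⟩
  rw [hsigma, mul_comm ((l - r)! * (r - s % r)! * (s % r)!), ← mul_assoc, Finset.sum_mul,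
    Finset.sum_congr rfl fun t _ => hsize t, Finset.sum_const, Finset.card_univ,
    ← Nat.card_eq_fintype_card, smul_eq_mul]
  rw [← htype]
  ring

theorem equipartiteDensity_turanGraph_of_lt {l : ℕ} (hr : 0 < r) (hrs : r ≤ s) (hl : l < r) :
    equipartiteDensity (SimpleGraph.turanGraph s r) l = 0 := by
  rw [equipartiteDensity_eq, copyCount_turanGraph_of_lt hr hrs hl, Nat.cast_zero, zero_div]

theorem equipartiteDensity_turanGraph {l : ℕ} (hr : 0 < r) (hrs : r ≤ s) (hl : r ≤ l) :
    equipartiteDensity (SimpleGraph.turanGraph s r) l = turanDensity s r l := by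
  have hq : s % r ≤ r := (Nat.mod_lt _ hr).le
  have h := congrArg (Nat.cast (R := ℝ)) (copyCount_turanGraph_mul hr hrs hl)
  have hl0 : (0 : ℝ) < l := by exact_mod_cast hr.trans_le hl
  have hpow : ((s / r)! : ℝ) ^ (r - s % r) * ((s / r + 1)! : ℝ) ^ (s % r) =
      ((s / r)! : ℝ) ^ r * ((s / r : ℕ) + 1 : ℝ) ^ (s % r) := by
    rw [Nat.factorial_succ, Nat.cast_mul, mul_pow, mul_left_comm, ← pow_add, Nat.sub_add_cancel hq,
      Nat.cast_add, Nat.cast_one, mul_comm]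
  push_cast at h
  rw [hpow] at h
  rw [equipartiteDensity_eq, turanDensity, Fintype.card_fin, div_eq_div_iff (by positivity)
    (by positivity), ← h]
  ring

theorem turanDensity_pos {l : ℕ} (hr : 0 < r) (hl : r ≤ l) : 0 < turanDensity s r l := by
  have hl0 : (0 : ℝ) < l := by exact_mod_cast hr.trans_le hl
  unfold turanDensity
  positivity

theorem turanDensity_succ {l : ℕ} (hr : 0 < r) (hs : 0 < s) (hl : r ≤ l) :
    turanDensity s r (l + 1) * ((l + 1 - r : ℕ) * (l + 1) ^ (s - 1) : ℕ) =
      turanDensity s r l * (l ^ s : ℕ) := by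
  have hl0 : (0 : ℝ) < l := by exact_mod_cast hr.trans_le hl
  obtain ⟨m, rfl⟩ := Nat.exists_eq_add_of_le hl
  obtain ⟨s, rfl⟩ : ∃ t, s = t + 1 := ⟨s - 1, by omega⟩
  have h1 : r + m + 1 - r = m + 1 := by omega
  have h2 : r + m - r = m := by omega
  unfold turanDensity
  rw [h1, h2, Nat.factorial_succ, Nat.factorial_succ m, Nat.add_sub_cancel]
  push_cast
  have : ((r : ℝ) + m) ≠ 0 := by exact_mod_cast hl0.ne'
  field_simp
  ring
end

/-! ### The optimal number of parts -/

section
variable {s r l : ℕ}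

theorem turanDensity_lt_succ (hr : 0 < r) (hs : 0 < s) (hl : r ≤ l)
    (h : (l + 1 - r) * (l + 1) ^ (s - 1) < l ^ s) :
    turanDensity s r l < turanDensity s r (l + 1) := by
  have h1 := turanDensity_succ hr hs hl
  have h2 := turanDensity_pos (s := s) hr (hl.trans l.le_succ)
  have h3 : (0 : ℝ) < (l ^ s : ℕ) := by exact_mod_cast (Nat.zero_le _).trans_lt h
  refine lt_of_mul_lt_mul_right (h1.symm.trans_lt ?_) h3.le
  exact mul_lt_mul_of_pos_left (by exact_mod_cast h) h2

theorem turanDensity_succ_lt (hr : 0 < r) (hs : 0 < s) (hl : r ≤ l)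
    (h : l ^ s < (l + 1 - r) * (l + 1) ^ (s - 1)) :
    turanDensity s r (l + 1) < turanDensity s r l := by
  have h1 := turanDensity_succ hr hs hl
  have h2 := turanDensity_pos (s := s) hr hl
  have h3 : (0 : ℝ) < ((l + 1 - r : ℕ) * (l + 1) ^ (s - 1) : ℕ) := by
    exact_mod_cast (Nat.zero_le _).trans_lt h
  refine lt_of_mul_lt_mul_right (h1.trans_lt ?_) h3.le
  exact mul_lt_mul_of_pos_left (by exact_mod_cast h) h2

/-- The Bonferroni bound (1 - 1/L)^s ≤ 1 - s/L + s(s-1)/(2L²), cleared of denominators. -/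
theorem two_mul_sq_mul_sub_one_pow_le {L : ℝ} (hL : 1 ≤ L) (s : ℕ) :
    2 * L ^ 2 * (L - 1) ^ s ≤ (2 * L ^ 2 - 2 * s * L + s * (s - 1)) * L ^ s := by
  induction s with
  | zero => simp
  | succ s ih =>
    have h1 := mul_le_mul_of_nonneg_right ih (sub_nonneg.2 hL)
    have h2 : (0 : ℝ) ≤ s * (s - 1) := by
      rcases s with _ | s
      · simp
      · push_cast; rw [add_sub_cancel_right]; positivity
    have h3 : 0 ≤ (s * (s - 1) : ℝ) * L ^ s := mul_nonneg h2 (by positivity)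
    rw [pow_succ (L - 1) s, pow_succ L s]
    push_cast
    linarith

/-- With L = l + 1 the claim is (1 - 1/L)^s < 1 - r/L. The second-order bound gives it once
s(s-1)/(2L) < s - r, which is `h`. -/
theorem pow_lt_sub_mul_pow (hrs : r ≤ s) (hl : r ≤ l) (hs : 0 < s)
    (h : s * (s - 1) < 2 * (s - r) * (l + 1)) : l ^ s < (l + 1 - r) * (l + 1) ^ (s - 1) := by
  obtain ⟨m, rfl⟩ := Nat.exists_eq_add_of_le hrs
  obtain ⟨n, rfl⟩ := Nat.exists_eq_add_of_le hl
  have h1 := two_mul_sq_mul_sub_one_pow_le (L := (r + n + 1 : ℕ))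
    (by exact_mod_cast Nat.le_add_left 1 _) (r + m)
  have h2 : r + n + 1 - r = n + 1 := by omega
  have h3 : r + m - r = m := by omega
  obtain ⟨j, hj⟩ : ∃ j, r + m = j + 1 := ⟨r + m - 1, by omega⟩
  rw [h2]
  rw [h3, hj, Nat.add_sub_cancel] at h
  rw [hj] at h1 ⊢
  rw [Nat.add_sub_cancel]
  have h' : ((j + 1 : ℕ) : ℝ) * j < 2 * m * (r + n + 1 : ℕ) := by exact_mod_cast h
  have hj' : (r : ℝ) + m = j + 1 := by exact_mod_cast hj
  have hL : (0 : ℝ) < (r + n + 1 : ℕ) := by positivity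
  have key : ((r + n : ℕ) : ℝ) ^ (j + 1) < (n + 1 : ℕ) * ((r + n + 1 : ℕ) : ℝ) ^ j := by
    have h4 : (((r + n + 1 : ℕ) : ℝ) - 1) = (r + n : ℕ) := by push_cast; ring
    rw [h4] at h1
    refine lt_of_mul_lt_mul_left (h1.trans_lt ?_)
      (by positivity : (0 : ℝ) ≤ 2 * ((r + n + 1 : ℕ) : ℝ) ^ 2)
    have h5 : 2 * ((r + n + 1 : ℕ) : ℝ) ^ 2 * ((n + 1 : ℕ) * ((r + n + 1 : ℕ) : ℝ) ^ j) =
        2 * ((r + n + 1 : ℕ) : ℝ) * (n + 1 : ℕ) * ((r + n + 1 : ℕ) : ℝ) ^ (j + 1) := by ring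
    rw [h5]
    refine mul_lt_mul_of_pos_right ?_ (by positivity)
    have h6 : ((n + 1 : ℕ) : ℝ) = (r + n + 1 : ℕ) - r := by push_cast; ring
    rw [h6]
    have h7 : ((j + 1 : ℕ) : ℝ) = r + m := by rw [hj']; push_cast; ring
    have h8 : ((j + 1 : ℕ) : ℝ) - 1 = j := by push_cast; ring
    rw [h8]
    nlinarith
  exact_mod_cast key

/-- Strict Bernoulli, (1 - 1/L)^s > 1 - s/L, for s = j + 2. For complete graphs it makes g strictly
increasing. -/
theorem pow_mul_sub_lt_sub_one_pow {L : ℝ} (hL : 1 < L) (j : ℕ) :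
    L ^ (j + 1) * (L - (j + 2)) < (L - 1) ^ (j + 2) := by
  induction j with
  | zero => norm_num; nlinarith
  | succ j ih =>
    have h1 := mul_lt_mul_of_pos_right ih (sub_pos.2 hL)
    have h2 : 0 < L ^ (j + 1) := by positivity
    have h3 : L ^ (j + 1 + 1) * (L - ((j + 1 : ℕ) + 2)) ≤
        L ^ (j + 1) * (L - (j + 2)) * (L - 1) := by
      rw [pow_succ L (j + 1), mul_assoc, mul_assoc]
      refine mul_le_mul_of_nonneg_left ?_ h2.le
      have : (0 : ℝ) ≤ j := Nat.cast_nonneg j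
      push_cast
      nlinarith
    exact h3.trans_lt (h1.trans_eq (pow_succ _ _).symm)

theorem sub_mul_pow_lt_pow (hs : 2 ≤ s) (hl : s ≤ l) :
    (l + 1 - s) * (l + 1) ^ (s - 1) < l ^ s := by
  obtain ⟨j, rfl⟩ := Nat.exists_eq_add_of_le' hs
  obtain ⟨n, rfl⟩ := Nat.exists_eq_add_of_le hl
  have h2 : j + 2 + n + 1 - (j + 2) = n + 1 := by omega
  have h := pow_mul_sub_lt_sub_one_pow (L := (j + 2 + n + 1 : ℕ))
    (by exact_mod_cast (by omega : 1 < j + 2 + n + 1)) j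
  have h3 : (((j + 2 + n + 1 : ℕ) : ℝ) - (j + 2)) = (n + 1 : ℕ) := by push_cast; ring
  have h4 : (((j + 2 + n + 1 : ℕ) : ℝ) - 1) = (j + 2 + n : ℕ) := by push_cast; ring
  rw [h3, h4] at h
  rw [h2, mul_comm]
  exact_mod_cast h

/-- `t` is the peak of `l ↦ turanDensity s r l`, and `num / den` is the value there. -/
def IsTuranPeak (s r t num den : ℕ) : Prop :=
  r ≤ t ∧ 0 < den ∧
  num * ((t - r)! * (r - s % r)! * (s % r)! * (s / r)! ^ r * (s / r + 1) ^ (s % r) * t ^ s) =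
    den * (t ! * s !) ∧
  (∀ l < t, r ≤ l → (l + 1 - r) * (l + 1) ^ (s - 1) < l ^ s) ∧
  ∀ l < 92, t ≤ l → l ^ s < (l + 1 - r) * (l + 1) ^ (s - 1)

instance (s r t num den : ℕ) : Decidable (IsTuranPeak s r t num den) := by
  unfold IsTuranPeak; infer_instance

theorem isTuranPeak_of_mem_turanTable :
    ∀ e ∈ turanTable, IsTuranPeak e.1 e.2.1 e.2.2.1 e.2.2.2.1 e.2.2.2.2 := by
  decide +kernel

theorem exists_mem_turanTable :
    ∀ s ≤ 14, ∀ r < s, 2 ≤ r → ∃ e ∈ turanTable, e.1 = s ∧ e.2.1 = r := by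
  decide +kernel

theorem equipartiteDensity_turanGraph_lt_of_lt {t m : ℕ} (hr : 0 < r) (hrs : r ≤ s)
    (hinc : ∀ l < t, r ≤ l → (l + 1 - r) * (l + 1) ^ (s - 1) < l ^ s) (hrl : r ≤ l) (hlt : l ≤ t)
    (hml : m < l) :
    equipartiteDensity (SimpleGraph.turanGraph s r) m <
      equipartiteDensity (SimpleGraph.turanGraph s r) l := by
  rw [equipartiteDensity_turanGraph hr hrs hrl]
  rcases lt_or_ge m r with hm | hm
  · rw [equipartiteDensity_turanGraph_of_lt hr hrs hm]
    exact turanDensity_pos hr hrl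
  rw [equipartiteDensity_turanGraph hr hrs hm]
  induction l, hml using Nat.le_induction with
  | base => exact turanDensity_lt_succ hr (hr.trans_le hrs) hm (hinc m hlt hm)
  | succ j hj ih =>
    have hrj : r ≤ j := hm.trans ((Nat.le_succ m).trans hj)
    exact (ih hrj (by omega)).trans
      (turanDensity_lt_succ hr (hr.trans_le hrs) hrj (hinc j hlt hrj))

theorem equipartiteDensity_turanGraph_lt_of_gt {t m : ℕ} (hr : 0 < r) (hrs : r ≤ s)
    (hdec : ∀ l, t ≤ l → l ^ s < (l + 1 - r) * (l + 1) ^ (s - 1)) (hrt : r ≤ t) (htm : t < m) :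
    equipartiteDensity (SimpleGraph.turanGraph s r) m <
      equipartiteDensity (SimpleGraph.turanGraph s r) t := by
  rw [equipartiteDensity_turanGraph hr hrs hrt,
    equipartiteDensity_turanGraph hr hrs (hrt.trans htm.le)]
  induction m, htm using Nat.le_induction with
  | base => exact turanDensity_succ_lt hr (hr.trans_le hrs) hrt (hdec t le_rfl)
  | succ j hj ih =>
    have htj : t ≤ j := (Nat.le_succ t).trans hj
    exact (turanDensity_succ_lt hr (hr.trans_le hrs) (hrt.trans htj) (hdec j htj)).trans ih

theorem turanGraph_cliqueFreeInducibility {k : ℕ} (hr : 2 ≤ r) (hrs : r ≤ s) (hrl : r ≤ l)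
    (hlk : l < k) (hmax : ∀ m, m < k → m ≠ l →
      equipartiteDensity (SimpleGraph.turanGraph s r) m <
        equipartiteDensity (SimpleGraph.turanGraph s r) l) :
    IsCliqueFreeInducibility (SimpleGraph.turanGraph s r) k (turanDensity s r l) ∧
      UniquelyAttainedEquipartite (SimpleGraph.turanGraph s r) k (turanDensity s r l) l := by
  have hr0 : 0 < r := by omega
  rw [← equipartiteDensity_turanGraph hr0 hrs hrl]
  refine ⟨isCliqueFreeInducibility_of_isMax (turanGraph_isCompleteMultipartite s r)
    (turanGraph_hasBalancedParts hr0) (turanGraph_ne_bot hr hrs) (hr0.trans_le hrl) hlk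
    fun m _ hm => ?_, uniquelyAttainedEquipartite_of_isMax (turanGraph_hasBalancedParts hr0)
      (turanGraph_ne_bot hr hrs) (hr0.trans_le hrl) (by exact_mod_cast hlk) ?_
      fun m _ hm hml => hmax m (by exact_mod_cast hm) hml⟩
  · rcases eq_or_ne m l with rfl | hml
    · exact le_rfl
    · exact (hmax m hm hml).le
  · rw [equipartiteDensity_turanGraph hr0 hrs hrl]
    exact turanDensity_pos hr0 hrl

theorem turanGraph_cliqueFreeInducibility_of_le {k : ℕ} (hr : 2 ≤ r) (hrs : r ≤ s) (hk : 2 ≤ k)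
    (hkr : k ≤ r) : IsCliqueFreeInducibility (SimpleGraph.turanGraph s r) k 0 := by
  have hr0 : 0 < r := by omega
  -- All equipartite densities with fewer than `k ≤ r` parts are 0, so the single part `l = 1` is
  -- already a maximizer.
  rw [← equipartiteDensity_turanGraph_of_lt (l := 1) hr0 hrs (by omega)]
  refine isCliqueFreeInducibility_of_isMax (turanGraph_isCompleteMultipartite s r)
    (turanGraph_hasBalancedParts hr0) (turanGraph_ne_bot hr hrs) le_rfl (by omega) fun m _ hm => ?_
  rw [equipartiteDensity_turanGraph_of_lt hr0 hrs (by omega : m < r)]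
  exact equipartiteDensity_nonneg _ _
end

theorem theorem1p4 (s r : ℕ) (hr : 2 ≤ r) (hrs : r ≤ s) (hs : s ≤ 14) :
    -- the noncomplete Turan graphs, through the table
    (r < s → ∃ t num den : ℕ, (s, r, t, num, den) ∈ turanTable ∧
      IsInducibility (SimpleGraph.turanGraph s r) ((num : ℝ) / den) ∧
      UniquelyAttainedEquipartite (SimpleGraph.turanGraph s r) ⊤ ((num : ℝ) / den) t ∧
      ∀ k : ℕ, 3 ≤ k →
        (k ≤ r → IsCliqueFreeInducibility (SimpleGraph.turanGraph s r) k 0) ∧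
        (r < k → k ≤ t →
          IsCliqueFreeInducibility (SimpleGraph.turanGraph s r) k (turanDensity s r (k - 1)) ∧
          UniquelyAttainedEquipartite (SimpleGraph.turanGraph s r) k
            (turanDensity s r (k - 1)) (k - 1)) ∧
        (t < k →
          IsCliqueFreeInducibility (SimpleGraph.turanGraph s r) k ((num : ℝ) / den) ∧
          UniquelyAttainedEquipartite (SimpleGraph.turanGraph s r) k ((num : ℝ) / den) t)) ∧
    -- the complete graphs
    (r = s →
      IsInducibility (SimpleGraph.turanGraph s r) 1 ∧
      ∀ k : ℕ, 3 ≤ k →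
        (k ≤ r → IsCliqueFreeInducibility (SimpleGraph.turanGraph s r) k 0) ∧
        (r < k →
          IsCliqueFreeInducibility (SimpleGraph.turanGraph s r) k (turanDensity s r (k - 1)) ∧
          UniquelyAttainedEquipartite (SimpleGraph.turanGraph s r) k
            (turanDensity s r (k - 1)) (k - 1))) := by
  have hr0 : 0 < r := by omega
  refine ⟨fun hlt => ?_, fun heq => ?_⟩
  · obtain ⟨⟨s', r', t, num, den⟩, hmem, rfl, rfl⟩ := exists_mem_turanTable s hs r hlt hr
    obtain ⟨hrt, hden, hval, hinc, hdec⟩ := isTuranPeak_of_mem_turanTable _ hmem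
    simp only at hrt hden hval hinc hdec hr hrs hs hlt hr0 ⊢
    have hdec' : ∀ l, t ≤ l → l ^ s' < (l + 1 - r') * (l + 1) ^ (s' - 1) := by
      intro l hl
      -- For `s' ≤ 14` and `r' < s'` the analytic criterion holds as soon as 182 = 14 · 13 < 2(l +
      -- 1), so 92 is a sufficient cutoff; below it the table check covers every `l ≥ t`.
      rcases lt_or_ge l 92 with h | h
      · exact hdec l h hl
      · refine pow_lt_sub_mul_pow hrs (hrt.trans hl) (by omega) ?_
        have h1 : s' * (s' - 1) ≤ 14 * 13 := Nat.mul_le_mul hs (by omega)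
        have h2 : 2 * 1 * 93 ≤ 2 * (s' - r') * (l + 1) := by
          gcongr <;> omega
        omega
    have hv : turanDensity s' r' t = (num : ℝ) / den := by
      have h := congrArg (Nat.cast (R := ℝ)) hval
      push_cast at h
      have ht0 : (0 : ℝ) < t := by exact_mod_cast hr0.trans_le hrt
      have hden' : (0 : ℝ) < den := by exact_mod_cast hden
      rw [turanDensity, div_eq_div_iff (by positivity) hden'.ne']
      linarith
    have hpeak : ∀ m, m ≠ t → equipartiteDensity (SimpleGraph.turanGraph s' r') m <
        equipartiteDensity (SimpleGraph.turanGraph s' r') t := by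
      intro m hm
      rcases lt_or_gt_of_ne hm with h | h
      · exact equipartiteDensity_turanGraph_lt_of_lt hr0 hrs hinc hrt le_rfl h
      · exact equipartiteDensity_turanGraph_lt_of_gt hr0 hrs hdec' hrt h
    have hpeak' : ∀ m, equipartiteDensity (SimpleGraph.turanGraph s' r') m ≤
        equipartiteDensity (SimpleGraph.turanGraph s' r') t := by
      intro m
      rcases eq_or_ne m t with rfl | hm
      · exact le_rfl
      · exact (hpeak m hm).le
    have hpos : 0 < equipartiteDensity (SimpleGraph.turanGraph s' r') t := by
      rw [equipartiteDensity_turanGraph hr0 hrs hrt]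
      exact turanDensity_pos hr0 hrt
    refine ⟨t, num, den, hmem, ?_, ?_, fun k hk => ⟨fun hkr => ?_, fun hrk hkt => ?_, fun htk => ?_⟩⟩
    · rw [← hv, ← equipartiteDensity_turanGraph hr0 hrs hrt]
      exact isInducibility_of_isMax (turanGraph_isCompleteMultipartite s' r')
        (turanGraph_hasBalancedParts hr0) (turanGraph_ne_bot hr hrs) (hr0.trans_le hrt)
        fun m _ => hpeak' m
    · rw [← hv, ← equipartiteDensity_turanGraph hr0 hrs hrt]
      exact uniquelyAttainedEquipartite_of_isMax (turanGraph_hasBalancedParts hr0)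
        (turanGraph_ne_bot hr hrs) (hr0.trans_le hrt) (ENat.natCast_lt_top t) hpos
        fun m _ _ hm => hpeak m hm
    · exact turanGraph_cliqueFreeInducibility_of_le hr hrs (by omega) hkr
    -- Up to its peak `t` the density strictly increases in the number of parts, so the largest
    -- admissible number `k - 1` wins.
    · refine turanGraph_cliqueFreeInducibility hr hrs (by omega) (by omega) fun m hm hml => ?_
      exact equipartiteDensity_turanGraph_lt_of_lt hr0 hrs hinc (by omega) (by omega) (by omega)
    · rw [← hv]
      exact turanGraph_cliqueFreeInducibility hr hrs hrt htk fun m _ hm => hpeak m hm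
  · subst heq
    refine ⟨?_, fun k hk => ⟨fun hkr => ?_, fun hrk => ?_⟩⟩
    · rw [SimpleGraph.turanGraph_eq_top.2 (Or.inr le_rfl)]
      exact isInducibility_top
    · exact turanGraph_cliqueFreeInducibility_of_le hr hrs (by omega) hkr
    · refine turanGraph_cliqueFreeInducibility hr hrs (by omega) (by omega) fun m hm hml => ?_
      -- There is no peak here: the increase continues forever, and `k - 1` itself is taken as the
      -- upper end of the range.
      exact equipartiteDensity_turanGraph_lt_of_lt hr0 hrs
        (fun l _ hl => sub_mul_pow_lt_pow hr hl) (by omega) le_rfl (by omega)
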